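/- Theorem 3.5. Let $K$ be a field of characteristic $0$, let $X$ be an integral projective variety over $K$ of dimension $n$, let $L_1,L_2$ be line bundles on $X$, and let $S\subset X$ be a finite set of $r$ distinct regular points of $X$, all $K$-rational (if $K$ is algebraically closed this means that they are closed points). For $p\in S$ let $2p$ be the closed subscheme of $X$ with ideal sheaf $\mathfrak m_p^2$, and let $2S=\bigcup_{p\in S}2p$. For a $0$-dimensional closed subscheme $Z\subset X$ with ideal sheaf $\mathcal I_Z$ and length $\ell(Z)=\dim_K H^0(Z,\mathcal O_Z)$, and a line bundle $L$ on $X$, say that $Z$ imposes independent conditions on $L$ if $$h^0(\mathcal I_Z\otimes L)=h^0(L)-\ell(Z),$$ where $h^0$ is the dimension over $K$ of the space of global sections. Suppose that (1) $(X,L_1,S)$ satisfies condition $\dagger$: for every $p\in S$ the scheme $S\cup 2p$ imposes independent conditions on $L_1$; (2) $S$ imposes independent conditions on $L_2$. Then $2S$ imposes independent conditions on $L_1\otimes L_2$, and $$h^0(\mathcal I_{2S}\otimes L_1\otimes L_2)=h^0(L_1\otimes L_2)-(n+1)r.$$ Consequently $S$ does not belong to the $r$-th Terracini locus of $(X,L_1\otimes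 L_2)$, that is, to the set of those sets $T$ of $r$ distinct $K$-rational regular points of $X$ for which $h^0(\mathcal I_{2T}\otimes L_1\otimes L_2)>h^0(L_1\otimes L_2)-(n+1)r$. -/

import Mathlib

open CategoryTheory CategoryTheory.Limits AlgebraicGeometry TopologicalSpace

universe u

noncomputable section

namespace Terracini

variable {K : Type u} [Field K] {X : Scheme.{u}}

/-! ### Projective schemes over a field -/

attribute [local instance] MvPolynomial.gradedAlgebra

/-- Projective space `ℙ^N` over `K`, as `Proj K[x₀, …, x_N]`. -/
abbrev projectiveSpace (K : Type u) [Field K] (N : ℕ) : Scheme.{u} :=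
  Proj (MvPolynomial.homogeneousSubmodule (Fin (N + 1)) K)

/-- The structure morphism `ℙ^N ⟶ Spec K`. -/
def projectiveSpaceToSpec (K : Type u) [Field K] (N : ℕ) :
    projectiveSpace K N ⟶ Spec (.of K) :=
  Proj.toSpecZero (MvPolynomial.homogeneousSubmodule (Fin (N + 1)) K) ≫
    Spec.map (CommRingCat.ofHom
      (algebraMap K (MvPolynomial.homogeneousSubmodule (Fin (N + 1)) K 0)))

/-- `X` is projective over `K`: it is a closed subscheme of some `ℙ^N`, compatibly with the
structure morphisms to `Spec K`. -/
def IsProjective (f : X ⟶ Spec (.of K)) : Prop :=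
  ∃ (N : ℕ) (i : X ⟶ projectiveSpace K N), IsClosedImmersion i ∧ i ≫ projectiveSpaceToSpec K N = f

/-! ### Line bundles, tensor products, ideal sheaves -/

/-- The structure sheaf `𝒪_X`, as a sheaf of modules over itself. -/
def structureSheaf (X : Scheme.{u}) : X.Modules :=
  SheafOfModules.unit X.ringCatSheaf

/-- A line bundle: a sheaf of modules which is locally isomorphic to the structure sheaf. -/
def IsLineBundle (L : X.Modules) : Prop :=
  ∀ x : X, ∃ U : X.Opens, x ∈ U ∧ Nonempty (L.restrict U.ι ≅ structureSheaf (U : Scheme.{u}))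

/-- The presheaf `U ↦ M(U) ⊗_{𝒪(U)} N(U)`. -/
def presheafTensor (M N : X.Modules) : X.PresheafOfModules :=
  PresheafOfModules.Monoidal.tensorObj (R := X.presheaf) M.val N.val

/-- The tensor product `M ⊗ N` of sheaves of modules: the sheaf associated to
`U ↦ M(U) ⊗_{𝒪(U)} N(U)`. -/
def tensor (M N : X.Modules) : X.Modules :=
  (PresheafOfModules.sheafification (𝟙 X.ringCatSheaf.obj)).obj (presheafTensor M N)

/-- The restriction map `𝒪_X ⟶ ι_* 𝒪_Z` for the closed subscheme `ι : Z ⟶ X` cut out by `Z`. -/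
def toSubscheme (Z : X.IdealSheafData) :
    structureSheaf X ⟶ (Scheme.Modules.pushforward Z.subschemeι).obj (structureSheaf Z.subscheme) :=
  SheafOfModules.unitToPushforwardObjUnit Z.subschemeι.toRingCatSheafHom

/-- The ideal sheaf `ℐ_Z` of a closed subscheme `Z` of `X`, as a sheaf of modules:
the kernel of `𝒪_X ⟶ ι_* 𝒪_Z`. -/
def idealSheaf (Z : X.IdealSheafData) : X.Modules :=
  kernel (toSubscheme Z)

/-! ### Dimensions -/

/-- The ring homomorphism `K → Γ(X, 𝒪_X)` of a scheme over `K`. -/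
def scalars (f : X ⟶ Spec (.of K)) : K →+* Γ(X, ⊤) :=
  ((Scheme.ΓSpecIso (.of K)).inv ≫ f.appTop).hom

/-- `h⁰(M)`, the dimension over `K` of the space of global sections of `M`. -/
def h0 (f : X ⟶ Spec (.of K)) (M : X.Modules) : ℕ :=
  letI : Module K Γ(M, ⊤) := Module.compHom _ (scalars f)
  Module.finrank K Γ(M, ⊤)

/-- The length `ℓ(Z) = dim_K Γ(Z, 𝒪_Z)` of a `0`-dimensional closed subscheme `Z` of `X`. -/
def length (f : X ⟶ Spec (.of K)) (Z : X.IdealSheafData) : ℕ :=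
  letI : Algebra K Γ(Z.subscheme, ⊤) := (scalars (Z.subschemeι ≫ f)).toAlgebra
  Module.finrank K Γ(Z.subscheme, ⊤)

/-! ### Points, double points and unions of such

Closed subschemes are given by their quasi-coherent ideals; the scheme-theoretic union
corresponds to the intersection `⊓` of ideals. -/

/-- `p` is a regular point of `X`, and it is `K`-rational: the image of a section of
`X ⟶ Spec K`. (If `K` is algebraically closed, then the `K`-rational points are exactly the
closed points.) -/
structure IsRegularPoint (f : X ⟶ Spec (.of K)) (p : X) : Prop where
  regular : IsRegularLocalRing (X.presheaf.stalk p)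
  rational : ∃ s : Spec (.of K) ⟶ X, s ≫ f = 𝟙 _ ∧ s (IsLocalRing.closedPoint K) = p

/-- The reduced point `p` (for `p` a closed point), with ideal `𝔪_p`. -/
def point (p : X) : X.IdealSheafData :=
  Scheme.IdealSheafData.vanishingIdeal (Closeds.closure {p})

/-- The double point `2p = (2p, X)`, with ideal `𝔪_p²`. -/
def doublePoint (p : X) : X.IdealSheafData := point p ^ 2

/-- A finite set `S` of closed points as a reduced closed subscheme. -/
def points (S : Finset X) : X.IdealSheafData := ⨅ p ∈ S, point p

/-- `2S`, the union of the double points `2p` for `p ∈ S`. -/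
def doublePoints (S : Finset X) : X.IdealSheafData := ⨅ p ∈ S, doublePoint p

/-! ### Independent conditions, condition `†`, Terracini loci -/

/-- `Z` imposes independent conditions on `L`: `h⁰(ℐ_Z ⊗ L) = h⁰(L) - ℓ(Z)`. -/
def ImposesIndependentConditions (f : X ⟶ Spec (.of K)) (Z : X.IdealSheafData) (L : X.Modules) :
    Prop :=
  (h0 f (tensor (idealSheaf Z) L) : ℤ) = (h0 f L : ℤ) - (length f Z : ℤ)

/-- Condition `†` for `(X, L, S)`: for every `p ∈ S`, the scheme `S ∪ 2p` imposes independent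
conditions on `L`. -/
def ConditionDagger (f : X ⟶ Spec (.of K)) (L : X.Modules) (S : Finset X) : Prop :=
  ∀ p ∈ S, ImposesIndependentConditions f (points S ⊓ doublePoint p) L

/-- The `r`-th Terracini locus of `(X, L)`, where `n` is the dimension of `X`: the sets `S` of
`r` distinct regular points with `h⁰(ℐ_{2S} ⊗ L) > h⁰(L) - (n + 1) r`. -/
def terraciniLocus (f : X ⟶ Spec (.of K)) (n r : ℕ) (L : X.Modules) : Set (Finset X) :=
  {S | (∀ p ∈ S, IsRegularPoint f p) ∧ S.card = r ∧
    (h0 f (tensor (idealSheaf (doublePoints S)) L) : ℤ) > (h0 f L : ℤ) - ((n : ℤ) + 1) * (r : ℤ)}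

end Terracini

end

/-! Independence of conditions is an interpolation property. Give each `p ∈ S` an affine
neighbourhood `U p` that contains no other point of `S` and trivialises the line bundles. If `Z` is
supported on `S`, then `Γ(Z, 𝒪_Z)` is the product over `p ∈ S` of the rings `Γ(X, U p) / I_Z(U p)`,
and the image of `Γ(ℐ_Z ⊗ L)` in `Γ(L)` is the kernel of evaluation into this product. By
rank–nullity, `Z` imposes independent conditions on `L` exactly when evaluation is surjective
(`imposesIndependentConditions_iff`).

The theorem is then a computation with products (`exists_sum_mul_sub_mem_sq`). To prescribe `c`
modulo `𝔪_p²`, and `0` modulo `𝔪_q²` for `q ≠ p`, take a section `t` of `L₂` with value `1` at `p`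
and `0` at the other points. By condition `†` some section `s` of `L₁` is congruent to `c(2 - t)`
modulo `𝔪_p²` and vanishes at the other points. As `t(2 - t) = 1 - (t - 1)²`, the product `s ⊗ t`
has the required jets. Sums over `p` give every jet along `2S`.

Two inputs remain. Rank–nullity needs `Γ(L)` to be finite-dimensional (`finite_sections`): sections
are rational functions with a common denominator on each standard chart, and multiples of them are
integral over a homogeneous coordinate ring. The length `(n + 1) r` needs `dim 𝒪_p / 𝔪_p² = n + 1`,
that is, regularity together with `dim 𝒪_p = dim X` (`ringKrullDim_stalk_of_rational`); the latter
rests on Noether normalisation and going down. Characteristic zero enters both inputs as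
separability of fraction field extensions. -/

noncomputable section

namespace Terracini

section

variable {X : Scheme.{u}}

/-! ### Sections and restriction maps -/

/-- Restriction of functions. -/
def resFun {U V : X.Opens} (h : V ≤ U) : Γ(X, U) →+* Γ(X, V) :=
  (X.presheaf.map (homOfLE h).op).hom

/-- Restriction of sections of a sheaf of modules. -/
def res (M : X.Modules) {U V : X.Opens} (h : V ≤ U) : Γ(M, U) →+ Γ(M, V) :=
  (M.presheaf.map (homOfLE h).op).hom

lemma resFun_self {U : X.Opens} (a : Γ(X, U)) : resFun le_rfl a = a :=
  ConcreteCategory.congr_hom (X.presheaf.map_id (.op U)) a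

variable (M N : X.Modules)

lemma res_self {U : X.Opens} (a : Γ(M, U)) : res M le_rfl a = a :=
  ConcreteCategory.congr_hom (M.presheaf.map_id (.op U)) a

lemma res_res {U V W : X.Opens} (h : V ≤ U) (h' : W ≤ V) (a : Γ(M, U)) :
    res M h' (res M h a) = res M (h'.trans h) a :=
  (ConcreteCategory.congr_hom (M.presheaf.map_comp (homOfLE h).op (homOfLE h').op) a).symm

lemma res_smul {U V : X.Opens} (h : V ≤ U) (a : Γ(X, U)) (s : Γ(M, U)) :
    res M h (a • s) = resFun h a • res M h s :=
  Scheme.Modules.map_smul M (homOfLE h) a s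

variable {M N} in
lemma app_res (φ : M ⟶ N) {U V : X.Opens} (h : V ≤ U) (s : Γ(M, U)) :
    φ.app V (res M h s) = res N h (φ.app U s) :=
  ConcreteCategory.congr_hom (φ.mapPresheaf.naturality (homOfLE h).op) s

lemma eq_of_locally_eq {U : X.Opens} (s t : Γ(M, U))
    (h : ∀ x ∈ U, ∃ (V : X.Opens) (i : V ≤ U), x ∈ V ∧ res M i s = res M i t) : s = t := by
  choose V i hx e using h
  exact TopCat.Sheaf.eq_of_locally_eq' ⟨M.presheaf, M.isSheaf⟩ (fun x : U => V x.1 x.2) U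
    (fun x => homOfLE (i x.1 x.2)) (fun x hxU => Opens.mem_iSup.2 ⟨⟨x, hxU⟩, hx x hxU⟩) s t
    (fun x => e x.1 x.2)

lemma exists_glue {U : X.Opens} {ι : Type u} (V : ι → X.Opens) (i : ∀ j, V j ≤ U)
    (hV : ∀ x ∈ U, ∃ j, x ∈ V j) (s : ∀ j, Γ(M, V j))
    (hs : ∀ j k, res M inf_le_left (s j) = res M (inf_le_right : V j ⊓ V k ≤ V k) (s k)) :
    ∃ t : Γ(M, U), ∀ j, res M (i j) t = s j := by
  obtain ⟨t, ht, -⟩ := TopCat.Sheaf.existsUnique_gluing' ⟨M.presheaf, M.isSheaf⟩ V U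
    (fun j => homOfLE (i j)) (fun x hxU => Opens.mem_iSup.2 (hV x hxU)) s
    (fun j k => hs j k)
  exact ⟨t, ht⟩

variable {M N}

/-- A natural injective map of sheaves of sets on `U` is surjective if it is locally so. -/
lemma exists_eq_of_locally_exists {U : X.Opens} (α : ∀ V, V ≤ U → Γ(M, V) → Γ(N, V))
    (hα : ∀ V W (hV : V ≤ U) (h : W ≤ V) (m : Γ(M, V)),
      α W (h.trans hV) (res M h m) = res N h (α V hV m))
    (inj : ∀ V hV, Function.Injective (α V hV)) (t : Γ(N, U))
    (h : ∀ x ∈ U, ∃ (V : X.Opens) (i : V ≤ U), x ∈ V ∧ ∃ m, α V i m = res N i t) :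
    ∃ m, α U le_rfl m = t := by
  choose V i hx m hm using h
  obtain ⟨s, hs⟩ := exists_glue M (fun x : U => V x.1 x.2) (fun x => i x.1 x.2)
    (fun x hxU => ⟨⟨x, hxU⟩, hx x hxU⟩) (fun x => m x.1 x.2) (fun j k => by
      apply inj _ (inf_le_left.trans (i j.1 j.2))
      rw [hα _ _ (i j.1 j.2), hm, hα _ _ (i k.1 k.2), hm, res_res, res_res])
  refine ⟨s, eq_of_locally_eq _ _ _ fun x hxU => ⟨V x hxU, i x hxU, hx x hxU, ?_⟩⟩
  rw [← hα, hs ⟨x, hxU⟩, hm]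

lemma app_injective_of_locally (φ : M ⟶ N)
    (h : ∀ x : X, ∃ U : X.Opens, x ∈ U ∧ ∀ V ≤ U, Function.Injective (φ.app V)) (U : X.Opens) :
    Function.Injective (φ.app U) := by
  intro s t hst
  refine eq_of_locally_eq _ _ _ fun x hx => ?_
  obtain ⟨V, hxV, hV⟩ := h x
  refine ⟨V ⊓ U, inf_le_right, ⟨hxV, hx⟩, hV _ inf_le_left ?_⟩
  rw [app_res, app_res, hst]

/-! ### Local generators -/

/-- The section `e` freely generates `M` on `U`. -/
def IsGenerator (M : X.Modules) {U : X.Opens} (e : Γ(M, U)) : Prop :=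
  ∀ V (h : V ≤ U), Function.Bijective fun a : Γ(X, V) => a • res M h e

lemma IsGenerator.res {U V : X.Opens} {e : Γ(M, U)} (he : IsGenerator M e) (h : V ≤ U) :
    IsGenerator M (res M h e) := fun W hW => by
  simpa only [res_res] using he W (hW.trans h)

/-- `M` is locally free of rank one. -/
def HasLocalGenerators (M : X.Modules) : Prop :=
  ∀ x : X, ∃ U : X.Opens, x ∈ U ∧ ∃ e : Γ(M, U), IsGenerator M e

lemma IsLineBundle.hasLocalGenerators {L : X.Modules} (hL : IsLineBundle L) :
    HasLocalGenerators L := by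
  intro x
  obtain ⟨U, hxU, ⟨φ⟩⟩ := hL x
  let e : Γ(L, U.ι ''ᵁ ⊤) := φ.inv.app ⊤ (1 : Γ(U, ⊤))
  refine ⟨U.ι ''ᵁ ⊤, by simpa using hxU, e, fun V hV => ?_⟩
  obtain ⟨W, rfl⟩ : ∃ W : U.toScheme.Opens, V = U.ι ''ᵁ W := ⟨U.ι ⁻¹ᵁ V, by
    rw [Scheme.Hom.image_preimage_eq_opensRange_inf]
    exact (inf_eq_right.2 (by simpa using hV)).symm⟩
  -- Sections of the restriction of `L` over `W` are sections of `L` over the image of `W`, but the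
  -- scalars are those of `U`; the two actions are matched by `U.ι.appIso W`.
  have h1 : ∀ a : Γ(X, U.ι ''ᵁ W), a • res L hV e =
      φ.inv.app W ((U.ι.appIso W).hom a : Γ(U, W)) := by
    intro a
    have h2 : res L hV e = φ.inv.app W (1 : Γ(U, W)) := by
      have := app_res φ.inv (le_top : W ≤ ⊤) (1 : Γ(U, ⊤))
      refine Eq.trans ?_ (this.symm.trans ?_)
      · rfl
      · congr 1
        exact map_one (resFun (X := U.toScheme) (le_top : W ≤ ⊤))
    rw [h2]
    have h3 := Scheme.Modules.Hom.app_smul φ.inv ((U.ι.appIso W).hom a : Γ(U, W))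
      (1 : Γ(U, W))
    refine Eq.trans ?_ (h3.symm.trans ?_)
    · change _ = ((U.ι.appIso W).inv ((U.ι.appIso W).hom a)) • (show Γ(L, U.ι ''ᵁ W) from _)
      simp
      rfl
    · congr 1
      exact mul_one (show Γ(U, W) from _)
  rw [funext h1]
  have h4 : Function.Bijective (φ.inv.app W) :=
    ConcreteCategory.bijective_of_isIso (φ.inv.app W)
  exact h4.comp (ConcreteCategory.bijective_of_isIso (U.ι.appIso W).hom)

/-! ### Tensor products -/

/-- The canonical map `M(U) ⊗ N(U) → (M ⊗ N)(U)`. -/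
def tensorUnit (M N : X.Modules) (U : X.Opens) :
    TensorProduct Γ(X, U) Γ(M, U) Γ(N, U) →ₗ[Γ(X, U)] Γ(tensor M N, U) :=
  (((PresheafOfModules.sheafificationAdjunction (𝟙 X.ringCatSheaf.obj)).unit.app
    (presheafTensor M N)).app (.op U)).hom

/-- The section `m ⊗ n` of `M ⊗ N`. -/
def tmul {U : X.Opens} (m : Γ(M, U)) (n : Γ(N, U)) : Γ(tensor M N, U) :=
  tensorUnit M N U (TensorProduct.tmul _ m n)

lemma res_tmul {U V : X.Opens} (h : V ≤ U) (m : Γ(M, U)) (n : Γ(N, U)) :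
    res (tensor M N) h (tmul m n) = tmul (res M h m) (res N h n) :=
  (ConcreteCategory.congr_hom ((CategoryTheory.toSheafify (Opens.grothendieckTopology X)
    (presheafTensor M N).presheaf).naturality (homOfLE h).op)
      (TensorProduct.tmul Γ(X, U) m n)).symm

lemma smul_tmul_left {U : X.Opens} (a : Γ(X, U)) (m : Γ(M, U)) (n : Γ(N, U)) :
    tmul (a • m) n = a • tmul m n := by
  rw [tmul, ← TensorProduct.smul_tmul', map_smul, tmul]

lemma smul_tmul_right {U : X.Opens} (a : Γ(X, U)) (m : Γ(M, U)) (n : Γ(N, U)) :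
    tmul m (a • n) = a • tmul m n := by
  rw [tmul, TensorProduct.tmul_smul, map_smul, tmul]

/-- Local injectivity of sheafification. With the local surjectivity below, it reduces
`IsGenerator.bijective_tmul` to tensor products of modules. -/
lemma exists_tmul_eq_zero {U : X.Opens} (m : Γ(M, U)) (n : Γ(N, U)) (h : tmul m n = 0)
    (x : X) (hx : x ∈ U) : ∃ (V : X.Opens) (i : V ≤ U), x ∈ V ∧
    TensorProduct.tmul Γ(X, V) (res M i m) (res N i n) = 0 := by
  obtain ⟨V, i, hi, hxV⟩ := (Presheaf.isLocallyInjective_toSheafify'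
    (Opens.grothendieckTopology X) (presheafTensor M N).presheaf).equalizerSieve_mem
      (X := .op U) (TensorProduct.tmul Γ(X, U) m n) 0 (by rw [map_zero]; exact h) x hx
  exact ⟨V, i.le, hxV, Eq.trans hi (map_zero _)⟩

lemma exists_res_eq_tensorUnit {U : X.Opens} (t : Γ(tensor M N, U)) (x : X) (hx : x ∈ U) :
    ∃ (V : X.Opens) (i : V ≤ U), x ∈ V ∧ ∃ q, res (tensor M N) i t = tensorUnit M N V q := by
  obtain ⟨V, i, ⟨q, hq⟩, hxV⟩ := (Presheaf.isLocallySurjective_toSheafify'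
    (Opens.grothendieckTopology X) (presheafTensor M N).presheaf).imageSieve_mem (U := U) t x hx
  exact ⟨V, i.le, hxV, q, hq.symm⟩

lemma tmul_add_left {U : X.Opens} (m m' : Γ(M, U)) (n : Γ(N, U)) :
    tmul (m + m') n = tmul m n + tmul m' n := by
  rw [tmul, TensorProduct.add_tmul, map_add]; rfl

lemma bijective_tmul_generator {R A B : Type*} [CommRing R] [AddCommGroup A] [Module R A]
    [AddCommGroup B] [Module R B] (e : B) (he : Function.Bijective fun a : R => a • e) :
    Function.Bijective fun m : A => TensorProduct.tmul R m e := by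
  let E : R ≃ₗ[R] B := LinearEquiv.ofBijective (LinearMap.toSpanSingleton R B e) he
  have : (fun m : A => TensorProduct.tmul R m e) =
      (TensorProduct.rid R A).symm.trans (TensorProduct.congr (LinearEquiv.refl R A) E) := by
    ext m
    have : E 1 = e := one_smul R e
    simp [this]
  rw [this]
  exact LinearEquiv.bijective _

/-- Below `U` the presheaf tensor product is already `M`, hence a sheaf, so sheafifying changes
nothing. Injectivity is local; it also makes local preimages agree on overlaps, which gives
surjectivity. -/
lemma IsGenerator.bijective_tmul {U : X.Opens} {e : Γ(N, U)} (he : IsGenerator N e) (V : X.Opens)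
    (h : V ≤ U) : Function.Bijective fun m : Γ(M, V) => tmul m (Terracini.res N h e) := by
  have inj : ∀ W (hW : W ≤ U), Function.Injective
      fun m : Γ(M, W) => tmul m (Terracini.res N hW e) := by
    intro W hW m m' hm
    rw [← sub_eq_zero]
    refine eq_of_locally_eq _ _ _ fun x hx => ?_
    obtain ⟨W', i, hxW', h0⟩ := exists_tmul_eq_zero (m - m') (Terracini.res N hW e) (by
      have := tmul_add_left (m - m') m' (Terracini.res N hW e)
      rw [sub_add_cancel] at this
      rw [← sub_eq_zero.2 hm]
      simp only [this, add_sub_cancel_right]) x hx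
    refine ⟨W', i, hxW', ?_⟩
    rw [res_res] at h0
    rw [map_zero]
    refine (bijective_tmul_generator _ (he W' (i.trans hW))).1 (Eq.trans h0 ?_)
    exact (TensorProduct.zero_tmul _ _).symm
  refine ⟨inj V h, fun t => ?_⟩
  refine exists_eq_of_locally_exists (M := M) (N := tensor M N) (U := V)
    (fun W hW m => tmul m (Terracini.res N (hW.trans h) e)) ?_ (fun W hW => inj W _) t ?_
  · intro W W' hW hW' m
    rw [res_tmul, res_res]
  · intro x hx
    obtain ⟨W, i, hxW, q, hq⟩ := exists_res_eq_tensorUnit t x hx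
    obtain ⟨m, rfl⟩ := (bijective_tmul_generator _ (he W (i.trans h))).2 q
    exact ⟨W, i, hxW, m, hq.symm⟩

lemma IsGenerator.tmul {U : X.Opens} {e : Γ(M, U)} {e' : Γ(N, U)} (he : IsGenerator M e)
    (he' : IsGenerator N e') : IsGenerator (tensor M N) (tmul e e') := fun V h => by
  have := (he'.bijective_tmul (M := M) V h).comp (he V h)
  convert this using 2 with a
  simp only [Function.comp, res_tmul, smul_tmul_left]

lemma HasLocalGenerators.tensor (hM : HasLocalGenerators M) (hN : HasLocalGenerators N) :
    HasLocalGenerators (tensor M N) := by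
  intro x
  obtain ⟨U, hxU, e, he⟩ := hM x
  obtain ⟨U', hxU', e', he'⟩ := hN x
  exact ⟨U ⊓ U', ⟨hxU, hxU'⟩, _, (he.res inf_le_left).tmul (he'.res inf_le_right)⟩

end

section

variable {X : Scheme.{u}}

/-! ### The ideal sheaf and its twists -/

/-- The inclusion `ℐ_Z(U) → 𝒪_X(U)`. -/
def idealIncl (Z : X.IdealSheafData) (U : X.Opens) : Γ(idealSheaf Z, U) →ₗ[Γ(X, U)] Γ(X, U) :=
  ((kernel.ι (toSubscheme Z)).val.app (.op U)).hom

lemma idealIncl_injective (Z : X.IdealSheafData) (U : X.Opens) :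
    Function.Injective (idealIncl Z U) := by
  have : Mono ((Scheme.Modules.toPresheaf X).map (kernel.ι (toSubscheme Z))) := inferInstance
  have h2 := (NatTrans.mono_iff_mono_app _).1 this (.op U)
  exact (AddCommGrpCat.mono_iff_injective _).1 h2

/-- Taking sections over `U` preserves kernels. -/
lemma range_idealIncl (Z : X.IdealSheafData) (U : X.Opens) (a : Γ(X, U)) :
    a ∈ Set.range (idealIncl Z U) ↔ Z.subschemeι.app U a = 0 := by
  let F := Scheme.Modules.toPresheaf X ⋙ (evaluation _ _).obj (.op U)
  let T : ShortComplex X.Modules := ShortComplex.mk (kernel.ι (toSubscheme Z)) (toSubscheme Z)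
    (kernel.condition _)
  have hT : T.Exact := ShortComplex.exact_kernel _
  have : F.Additive := ⟨fun {_ _ _ _} => rfl⟩
  have : PreservesLimitsOfShape WalkingParallelPair ((evaluation (Opens X)ᵒᵖ Ab.{u}).obj (.op U)) :=
    evaluation_preservesLimitsOfShape _
  have : PreservesLimitsOfShape WalkingParallelPair F := comp_preservesLimitsOfShape _ _
  have hF := hT.map_of_mono_of_preservesKernel F inferInstance inferInstance
  have := (ShortComplex.ab_exact_iff _).1 hF
  constructor
  · rintro ⟨s, rfl⟩
    have := ConcreteCategory.congr_hom (T.map F).zero s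
    exact this
  · intro h
    exact this a h

/-- The multiplication `ℐ_Z ⊗ L → L`, on presheaves. -/
def presheafMul (Z : X.IdealSheafData) (L : X.Modules) :
    presheafTensor (idealSheaf Z) L ⟶ L.val :=
  MonoidalCategoryStruct.whiskerRight (C := PresheafOfModules (X.presheaf ⋙ forget₂ _ _))
      (kernel.ι (toSubscheme Z)).val L.val ≫
    (MonoidalCategoryStruct.leftUnitor (C := PresheafOfModules (X.presheaf ⋙ forget₂ _ _)) L.val).hom

/-- The multiplication `ℐ_Z ⊗ L → L`. -/
def mulMap (Z : X.IdealSheafData) (L : X.Modules) : tensor (idealSheaf Z) L ⟶ L :=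
  ((PresheafOfModules.sheafificationAdjunction (𝟙 X.ringCatSheaf.obj)).homEquiv _ _).symm
    (PresheafOfModules.homMk ((PresheafOfModules.toPresheaf _).map (presheafMul Z L))
      (fun U r m => ((presheafMul Z L).app U).hom.map_smul r m))

lemma mulMap_tmul (Z : X.IdealSheafData) (L : X.Modules) {U : X.Opens} (i : Γ(idealSheaf Z, U))
    (s : Γ(L, U)) : (mulMap Z L).app U (tmul i s) = idealIncl Z U i • s := by
  have h1 := Adjunction.homEquiv_unit
    (adj := PresheafOfModules.sheafificationAdjunction (𝟙 X.ringCatSheaf.obj))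
    (X := presheafTensor (idealSheaf Z) L) (Y := L) (f := mulMap Z L)
  rw [mulMap, Equiv.apply_symm_apply] at h1
  have h2 := congrArg (fun φ => (φ.app (.op U)).hom (TensorProduct.tmul Γ(X, U) i s)) h1
  refine h2.symm.trans ?_
  rfl

lemma mulMap_injective_of_isGenerator (Z : X.IdealSheafData) {L : X.Modules} {U : X.Opens}
    {e : Γ(L, U)} (he : IsGenerator L e) : Function.Injective ((mulMap Z L).app U) := by
  intro t t' h
  obtain ⟨i, rfl⟩ := (he.bijective_tmul U le_rfl).2 t
  obtain ⟨i', rfl⟩ := (he.bijective_tmul U le_rfl).2 t'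
  simp only [mulMap_tmul] at h
  have := (he U le_rfl).1 h
  rw [idealIncl_injective Z U this]

/-- This is where local freeness of `L` enters: where `e` generates, every section of `ℐ_Z ⊗ L` is
some `i ⊗ e`, and `i ⊗ e ↦ i • e` is injective. -/
lemma mulMap_injective (Z : X.IdealSheafData) {L : X.Modules} (hL : HasLocalGenerators L)
    (U : X.Opens) : Function.Injective ((mulMap Z L).app U) :=
  app_injective_of_locally _ (fun x => by
    obtain ⟨V, hxV, e, he⟩ := hL x
    exact ⟨V, hxV, fun W hW => mulMap_injective_of_isGenerator Z (he.res hW)⟩) U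

lemma exists_mulMap_eq_iff (Z : X.IdealSheafData) {L : X.Modules} {U : X.Opens}
    {e : Γ(L, U)} (he : IsGenerator L e) (a : Γ(X, U)) :
    (∃ t, (mulMap Z L).app U t = a • e) ↔ Z.subschemeι.app U a = 0 := by
  rw [← range_idealIncl]
  constructor
  · rintro ⟨t, ht⟩
    obtain ⟨i, rfl⟩ := (he.bijective_tmul U le_rfl).2 t
    simp only [mulMap_tmul, res_self] at ht
    exact ⟨i, (he U le_rfl).1 (by simpa only [res_self] using ht)⟩
  · rintro ⟨i, rfl⟩
    exact ⟨tmul i e, mulMap_tmul Z L i e⟩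

lemma mem_range_mulMap_of_locally (Z : X.IdealSheafData) {L : X.Modules}
    (hL : HasLocalGenerators L) (s : Γ(L, ⊤))
    (h : ∀ x : X, ∃ U : X.Opens, x ∈ U ∧ ∃ e : Γ(L, U), IsGenerator L e ∧
      ∃ a : Γ(X, U), res L le_top s = a • e ∧ Z.subschemeι.app U a = 0) :
    ∃ t, (mulMap Z L).app ⊤ t = s :=
  exists_eq_of_locally_exists (fun V _ => (mulMap Z L).app V)
    (fun _ _ _ h m => app_res (mulMap Z L) h m) (fun V _ => mulMap_injective Z hL V) s
    (fun x _ => by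
      obtain ⟨U, hxU, e, he, a, hs, ha⟩ := h x
      obtain ⟨t, ht⟩ := (exists_mulMap_eq_iff Z he a).2 ha
      exact ⟨U, le_top, hxU, t, ht.trans hs.symm⟩)

end

section

/-! ### Jets at a rational regular point -/

section Jets

open IsLocalRing

variable {K : Type*} [Field K]

lemma finrank_eq_one_of_algebraMap_surjective (B : Type*) [CommRing B] [Nontrivial B] [Algebra K B]
    (h : Function.Surjective (algebraMap K B)) : Module.finrank K B = 1 := by
  have e : K ≃ₗ[K] B := LinearEquiv.ofBijective (Algebra.linearMap K B)
    ⟨(algebraMap K B).injective, h⟩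
  rw [← e.finrank_eq, Module.finrank_self]

lemma finite_of_algebraMap_surjective (B : Type*) [CommRing B] [Algebra K B]
    (h : Function.Surjective (algebraMap K B)) : Module.Finite K B :=
  Module.Finite.of_surjective (Algebra.linearMap K B) h

/-- Count dimensions in `0 → 𝔪/𝔪² → R/𝔪² → R/𝔪 → 0`, where `R/𝔪 = K`. -/
lemma finrank_quotient_maximalIdeal_sq (R : Type*) [CommRing R] [IsLocalRing R]
    [IsNoetherianRing R] [Algebra K R] (h : Function.Surjective (algebraMap K (ResidueField R))) :
    Module.Finite K (R ⧸ maximalIdeal R ^ 2) ∧ Module.finrank K (R ⧸ maximalIdeal R ^ 2) =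
      Module.finrank (ResidueField R) (CotangentSpace R) + 1 := by
  have h1 := finrank_eq_one_of_algebraMap_surjective _ h
  have := finite_of_algebraMap_surjective _ h
  have : IsScalarTower K (ResidueField R) (CotangentSpace R) :=
    IsScalarTower.of_algebraMap_smul fun k x => by
      have : algebraMap K (ResidueField R) k = algebraMap R (ResidueField R) (algebraMap K R k) :=
        rfl
      rw [this, algebraMap_smul, algebraMap_smul]
  have h2 : Module.finrank K (CotangentSpace R) =
      Module.finrank (ResidueField R) (CotangentSpace R) := by
    rw [← Module.finrank_mul_finrank K (ResidueField R) (CotangentSpace R), h1, one_mul]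
  have : Module.Finite K (CotangentSpace R) := Module.Finite.trans (ResidueField R) _
  let i : CotangentSpace R →ₗ[K] R ⧸ maximalIdeal R ^ 2 :=
    (maximalIdeal R).cotangentToQuotientSquare.restrictScalars K
  let q : (R ⧸ maximalIdeal R ^ 2) →ₗ[K] R ⧸ maximalIdeal R :=
    (Ideal.Quotient.factorₐ K (Ideal.pow_le_self two_ne_zero)).toLinearMap
  have hq : Function.Surjective q := Ideal.Quotient.factor_surjective (Ideal.pow_le_self two_ne_zero)
  have hi : Function.Injective i := (maximalIdeal R).cotangentToQuotientSquare_injective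
  have hiq : LinearMap.ker q = LinearMap.range i := by
    ext x
    obtain ⟨x, rfl⟩ := Ideal.Quotient.mk_surjective x
    constructor
    · intro hx
      have hx' : x ∈ maximalIdeal R := Ideal.Quotient.eq_zero_iff_mem.1 hx
      exact ⟨(maximalIdeal R).toCotangent ⟨x, hx'⟩, rfl⟩
    · rintro ⟨y, hy⟩
      obtain ⟨y, rfl⟩ := (maximalIdeal R).toCotangent_surjective y
      rw [← hy]
      exact Ideal.Quotient.eq_zero_iff_mem.2 y.2
  have hfin : Module.Finite K (R ⧸ maximalIdeal R) := finite_of_algebraMap_surjective (ResidueField R) h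
  have : Module.Finite K (LinearMap.ker q) := by
    rw [hiq]; infer_instance
  have hfin2 : Module.Finite K (R ⧸ maximalIdeal R ^ 2) := by
    have : Module.Finite K ((R ⧸ maximalIdeal R ^ 2) ⧸ LinearMap.ker q) :=
      Module.Finite.equiv (q.quotKerEquivOfSurjective hq).symm
    exact Module.Finite.of_submodule_quotient (LinearMap.ker q)
  refine ⟨hfin2, ?_⟩
  rw [← LinearMap.finrank_range_add_finrank_ker q, hiq, LinearMap.finrank_range_of_inj hi, h2,
    LinearMap.range_eq_top.2 hq, finrank_top, add_comm]
  congr 1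

lemma finrank_quotient_sq_of_isRegularLocalRing {A : Type*} [CommRing A] [Algebra K A]
    (m : Ideal A) [hm : m.IsMaximal] (hK : Function.Surjective (algebraMap K (A ⧸ m)))
    (R : Type*) [CommRing R] [Algebra A R] [IsLocalization.AtPrime R m] [IsRegularLocalRing R]
    {n : ℕ} (hn : ringKrullDim R = n) :
    Module.Finite K (A ⧸ m ^ 2) ∧ Module.finrank K (A ⧸ m ^ 2) = n + 1 := by
  let : Algebra K R := ((algebraMap A R).comp (algebraMap K A)).toAlgebra
  have : IsScalarTower K A R := IsScalarTower.of_algebraMap_eq' rfl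
  have hn' : Module.finrank (ResidueField R) (CotangentSpace R) = n := by
    have := (IsRegularLocalRing.iff_finrank_cotangentSpace R).1 inferInstance
    rw [hn] at this
    exact_mod_cast this
  have e (k : ℕ) : (A ⧸ m ^ k) ≃ₐ[K] R ⧸ maximalIdeal R ^ k :=
    (IsLocalization.AtPrime.equivQuotMaximalIdealPow m R k).restrictScalars K
  have hR : Function.Surjective (algebraMap K (ResidueField R)) := by
    intro x
    let e1 := IsLocalization.AtPrime.equivQuotMaximalIdeal m R
    obtain ⟨k, hk⟩ := hK (e1.symm x)
    refine ⟨k, ?_⟩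
    apply e1.symm.injective
    exact ((RingEquiv.symm_apply_eq _).2 rfl).trans hk
  obtain ⟨h1, h2⟩ := finrank_quotient_maximalIdeal_sq R hR
  exact ⟨Module.Finite.equiv (e 2).symm.toLinearEquiv, by rw [(e 2).toLinearEquiv.finrank_eq, h2, hn']⟩

end Jets

/-! ### Dimension of finitely generated domains -/

section Dimension

open scoped Pointwise in
-- Lying over and going up give some chain `Q₀ ≤ Q₁` over the given pair of primes. The Galois group
-- is transitive on the primes over a prime of `P`, so a conjugate of this chain ends at the
-- prescribed `Q`.
lemma hasGoingDown_of_isGalois (P B E L : Type*) [CommRing P] [IsDomain P] [IsIntegrallyClosed P]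
    [CommRing B] [Algebra P B] [Field E] [Algebra P E] [IsFractionRing P E] [Field L] [Algebra E L]
    [Algebra P L] [IsScalarTower P E L] [Algebra B L] [IsScalarTower P B L]
    [IsIntegralClosure B P L] [FiniteDimensional E L] [IsGalois E L] :
    Algebra.HasGoingDown P B where
  exists_ideal_le_liesOver_of_lt {p} hp Q hQ hlt := by
    have : Algebra.IsIntegral P B := IsIntegralClosure.isIntegral_algebra P L
    have hinj : Function.Injective (algebraMap P B) := by
      have h1 : Function.Injective (algebraMap P L) := by
        rw [IsScalarTower.algebraMap_eq P E L]
        exact (algebraMap E L).injective.comp (IsFractionRing.injective P E)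
      rw [IsScalarTower.algebraMap_eq P B L] at h1
      exact Function.Injective.of_comp h1
    obtain ⟨Q₀, -, hQ₀, h₀⟩ := Ideal.exists_ideal_over_prime_of_isIntegral p (⊥ : Ideal B) (by
      intro x hx
      rw [(injective_iff_map_eq_zero _).1 hinj x hx]
      exact p.zero_mem)
    obtain ⟨Q₁, hle, hQ₁, h₁⟩ := Ideal.exists_ideal_over_prime_of_isIntegral (Q.under P) Q₀ (by
      rw [h₀]; exact hlt.le)
    have : IsDomain B := (IsIntegralClosure.algebraMap_injective B P L).isDomain
    have := IsIntegralClosure.isFractionRing_of_finite_extension P E L B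
    have := Algebra.isInvariant_of_isGalois' P E L B
    have : Finite (B ≃ₐ[P] B) := Finite.of_equiv _ (galRestrict P E L B).toEquiv
    obtain ⟨g, rfl⟩ := Algebra.IsInvariant.exists_smul_of_under_eq P B (B ≃ₐ[P] B) Q₁ Q h₁
    refine ⟨g • Q₀, Ideal.pointwise_smul_le_pointwise_smul_iff.2 hle, hQ₀.smul g, ⟨?_⟩⟩
    rw [Ideal.under_smul]
    exact h₀.symm

/-- Lift the prime from `A` to `B`, go down there, and contract back to `A`. -/
lemma hasGoingDown_of_tower (P A B : Type*) [CommRing P] [CommRing A] [CommRing B] [Algebra P A]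
    [Algebra A B] [Algebra P B] [IsScalarTower P A B] [Algebra.IsIntegral A B]
    (h : Function.Injective (algebraMap A B)) [Algebra.HasGoingDown P B] :
    Algebra.HasGoingDown P A where
  exists_ideal_le_liesOver_of_lt {p} hp Q hQ hlt := by
    obtain ⟨Q', -, hQ', h'⟩ := Ideal.exists_ideal_over_prime_of_isIntegral Q (⊥ : Ideal B) (by
      intro x hx
      rw [(injective_iff_map_eq_zero _).1 h x hx]
      exact Q.zero_mem)
    have h2 : Q'.under P = Q.under P := by
      rw [← h', ← Ideal.under_def, Ideal.under_under]
    obtain ⟨R, hR, hR', hR2⟩ := Algebra.HasGoingDown.exists_ideal_le_liesOver_of_lt (R := P) (p := p)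
      Q' (by rwa [h2])
    refine ⟨R.under A, ?_, inferInstance, ⟨?_⟩⟩
    · rw [← h']
      exact Ideal.comap_mono hR
    · rw [Ideal.under_under]
      exact hR2.over

/-- Going down for finite extensions of integrally closed domains (in characteristic zero). -/
lemma hasGoingDown_of_isIntegrallyClosed (P A : Type*) [CommRing P] [IsDomain P]
    [IsIntegrallyClosed P] [CharZero P] [CommRing A] [IsDomain A] [Algebra P A] [FaithfulSMul P A]
    [Module.Finite P A] : Algebra.HasGoingDown P A := by
  let E := FractionRing P
  let Q := FractionRing A
  let : Algebra E Q := FractionRing.liftAlgebra P Q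
  have : IsScalarTower P E Q := inferInstance
  have : FiniteDimensional E Q := inferInstance
  have : CharZero E := charZero_of_injective_algebraMap (IsFractionRing.injective P E)
  -- Characteristic zero makes the normal closure Galois over `E`; the integral ring `A` embeds in
  -- the integral closure of `P` in it.
  let L := IntermediateField.normalClosure E Q (AlgebraicClosure Q)
  have : IsGalois E L := ⟨⟩
  let : Algebra A L := ((algebraMap Q L).comp (algebraMap A Q)).toAlgebra
  have : IsScalarTower A Q L := IsScalarTower.of_algebraMap_eq' rfl
  have : IsScalarTower P A L := IsScalarTower.of_algebraMap_eq fun x => by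
    change _ = algebraMap Q L (algebraMap A Q (algebraMap P A x))
    rw [← IsScalarTower.algebraMap_apply P A Q, IsScalarTower.algebraMap_apply P E Q,
      ← IsScalarTower.algebraMap_apply E Q L, ← IsScalarTower.algebraMap_apply P E L]
  let B := integralClosure P L
  let φ : A →ₐ[P] B := AlgHom.codRestrict (IsScalarTower.toAlgHom P A L) B fun a =>
    (Algebra.IsIntegral.isIntegral (R := P) a).map (IsScalarTower.toAlgHom P A L)
  let : Algebra A B := φ.toAlgebra
  have : IsScalarTower P A B := IsScalarTower.of_algHom φ
  have : Algebra.HasGoingDown P B := hasGoingDown_of_isGalois P B E L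
  have : Algebra.IsIntegral A B := Algebra.IsIntegral.tower_top P
  refine hasGoingDown_of_tower P A B fun a b h => ?_
  have : algebraMap A L a = algebraMap A L b := congrArg Subtype.val h
  exact IsFractionRing.injective A Q ((algebraMap Q L).injective this)

/-- Induction on the variables: a maximal ideal contracts to a maximal ideal because polynomial
rings over a field are Jacobson, and its height exceeds that of the contraction by one. -/
lemma height_eq_of_isMaximal_mvPolynomial {K : Type*} [Field K] (s : ℕ)
    (m : Ideal (MvPolynomial (Fin s) K)) [hm : m.IsMaximal] : m.height = s := by
  induction s with
  | zero =>
    have h1 : m.height ≤ (0 : ℕ) := by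
      have := Ideal.height_le_ringKrullDim_of_ne_top hm.ne_top
      simpa using this
    simpa using h1
  | succ s ih =>
    let e := (MvPolynomial.finSuccEquiv K s).toRingEquiv
    have h1 : (m.map e).IsMaximal := Ideal.map_isMaximal_of_equiv e
    have h2 : ((m.map e).under (MvPolynomial (Fin s) K)).IsMaximal :=
      Polynomial.isMaximal_comap_C_of_isJacobsonRing _
    have : (m.map e).LiesOver ((m.map e).under (MvPolynomial (Fin s) K)) := ⟨rfl⟩
    have h3 := Polynomial.height_eq_height_add_one ((m.map e).under (MvPolynomial (Fin s) K))
      (m.map e)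
    rw [ih, e.height_map] at h3
    simpa using h3

/-- All maximal ideals of a finitely generated domain over a field of characteristic zero have
height equal to the transcendence degree. -/
theorem exists_trdeg_eq_height_eq (K A : Type u) [Field K] [CharZero K] [CommRing A] [IsDomain A]
    [Algebra K A] [Algebra.FiniteType K A] :
    ∃ s : ℕ, Algebra.trdeg K A = s ∧ ringKrullDim A ≤ s ∧
      ∀ m : Ideal A, m.IsMaximal → m.height = s := by
  obtain ⟨s, g, hg, hfin⟩ := exists_finite_inj_algHom_of_fg K A
  let P := MvPolynomial (Fin s) K
  let : Algebra P A := g.toAlgebra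
  have : IsScalarTower K P A := IsScalarTower.of_algHom g
  have : Module.Finite P A := hfin
  have : FaithfulSMul P A := (faithfulSMul_iff_algebraMap_injective P A).2 hg
  have : CharZero P := charZero_of_injective_algebraMap (algebraMap K P).injective
  have : Algebra.HasGoingDown P A := hasGoingDown_of_isIntegrallyClosed P A
  have : IsNoetherianRing A := Algebra.FiniteType.isNoetherianRing K A
  have hdim : ringKrullDim A ≤ s := by
    have h1 : ringKrullDim A ≤ ringKrullDim P := by
      refine Order.krullDim_le_of_strictMono (PrimeSpectrum.comap (algebraMap P A)) ?_
      intro p q h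
      exact Ideal.IsIntegral.comap_lt_comap (R := P) (I := p.asIdeal) (J := q.asIdeal) h
    refine h1.trans ?_
    simp [P]
  refine ⟨s, ?_, hdim, fun m hm => ?_⟩
  · rw [← trdeg_add_eq K P (A := A), trdeg_eq_zero (R := P), add_zero,
      MvPolynomial.trdeg_of_isDomain]
    simp
  · apply le_antisymm
    · have := Ideal.height_le_ringKrullDim_of_ne_top hm.ne_top
      exact_mod_cast this.trans hdim
    -- By going down, the height of `m` is that of its contraction, which is `s`, plus a height in
    -- the fibre; only `≥` is needed here.
    · have h1 : (m.under P).IsMaximal := Ideal.isMaximal_comap_of_isIntegral_of_isMaximal m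
      rw [Ideal.height_eq_height_add_of_liesOver_of_hasGoingDown (m.under P) m,
        height_eq_of_isMaximal_mvPolynomial]
      exact le_self_add

lemma trdeg_eq_of_isFractionRing (K A F : Type u) [Field K] [CommRing A] [IsDomain A] [Field F]
    [Algebra K A] [Algebra A F] [Algebra K F] [IsScalarTower K A F] [IsFractionRing A F] :
    Algebra.trdeg K A = Algebra.trdeg K F := by
  have : Algebra.IsAlgebraic A F := IsLocalization.isAlgebraic _ (nonZeroDivisors A)
  rw [← trdeg_add_eq K A (A := F), trdeg_eq_zero (R := A), add_zero]

end Dimension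

end

section

/-! ### Finiteness of spaces of rational functions with bounded denominators -/

section Finiteness

open Polynomial

/-- The integral closure of a finitely generated domain over a field of characteristic zero in its
fraction field is finite. -/
lemma finite_integralClosure_fractionRing (K B : Type*) [Field K] [CharZero K] [CommRing B]
    [IsDomain B] [Algebra K B] [Algebra.FiniteType K B] :
    Module.Finite B (integralClosure B (FractionRing B)) := by
  obtain ⟨s, g, hg, hfin⟩ := exists_finite_inj_algHom_of_fg K B
  let P := MvPolynomial (Fin s) K
  let : Algebra P B := g.toAlgebra
  have : IsScalarTower K P B := IsScalarTower.of_algHom g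
  have : Module.Finite P B := hfin
  have : FaithfulSMul P B := (faithfulSMul_iff_algebraMap_injective P B).2 hg
  have : CharZero P := charZero_of_injective_algebraMap (algebraMap K P).injective
  let E := FractionRing P
  let Q := FractionRing B
  let : Algebra E Q := FractionRing.liftAlgebra P Q
  have : IsScalarTower P E Q := inferInstance
  have : FiniteDimensional E Q := inferInstance
  have : CharZero E := charZero_of_injective_algebraMap (IsFractionRing.injective P E)
  let C := integralClosure B Q
  -- `B` is integral over `P`, so `C` is also the integral closure of the normal ring `P` in the
  -- separable extension `Q` of `E`; hence it is finite.
  have : IsIntegralClosure C P Q :=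
    { algebraMap_injective := Subtype.val_injective
      isIntegral_iff := by
        intro x
        constructor
        · intro hx
          exact ⟨⟨x, hx.tower_top⟩, rfl⟩
        · rintro ⟨y, rfl⟩
          exact isIntegral_trans (R := P) (A := B) y.1 y.2 }
  have := IsIntegralClosure.finite P E Q C
  exact Module.Finite.of_restrictScalars_finite P B C

/-- Elements of a field extension of `Frac B` which are integral over `B` and lie in `Frac B`
form a Noetherian module. -/
lemma exists_isNoetherian_of_isIntegral (K B E : Type*) [Field K] [CharZero K] [CommRing B]
    [IsDomain B] [Algebra K B] [Algebra.FiniteType K B] [Field E] [Algebra B E] [FaithfulSMul B E] :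
    ∃ M : Submodule B E, IsNoetherian B M ∧
      ∀ x, IsIntegral B x → ∀ b b' : B, b ≠ 0 → algebraMap B E b * x = algebraMap B E b' → x ∈ M := by
  have : IsNoetherianRing B := Algebra.FiniteType.isNoetherianRing K B
  let Q := FractionRing B
  let : Algebra Q E := FractionRing.liftAlgebra B E
  have : IsScalarTower B Q E := inferInstance
  let C := integralClosure B Q
  have : Module.Finite B C := finite_integralClosure_fractionRing K B
  let φ : C →ₗ[B] E := (IsScalarTower.toAlgHom B Q E).toLinearMap ∘ₗ C.val.toLinearMap
  refine ⟨LinearMap.range φ, inferInstance, fun x hx b b' hb h => ?_⟩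
  have hQ : algebraMap B Q b ≠ 0 := by
    simpa using hb
  have hE : algebraMap B E b ≠ 0 := by
    rw [Ne, FaithfulSMul.algebraMap_eq_zero_iff]
    exact hb
  let q : Q := algebraMap B Q b' / algebraMap B Q b
  have hq : algebraMap Q E q = x := by
    rw [map_div₀, ← IsScalarTower.algebraMap_apply, ← IsScalarTower.algebraMap_apply, ← h]
    field_simp
  have hqi : IsIntegral B q := by
    rw [← isIntegral_algebraMap_iff (algebraMap Q E).injective, hq]
    exact hx
  exact ⟨⟨q, hqi⟩, hq⟩

variable {K F : Type*} [Field K] [Field F] [Algebra K F] {N : ℕ} (z : Fin (N + 1) → F)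

/-- The homogeneous coordinate `z_j t`. -/
def coordHom : MvPolynomial (Fin (N + 1)) K →ₐ[K] F[X] :=
  MvPolynomial.aeval fun j => C (z j) * X

lemma coordHom_of_isHomogeneous {a : MvPolynomial (Fin (N + 1)) K} {d : ℕ}
    (ha : a.IsHomogeneous d) : coordHom z a = C (MvPolynomial.aeval z a) * X ^ d := by
  have h1 : ∀ α : Fin (N + 1) →₀ ℕ, ∀ c : K, coordHom z (MvPolynomial.monomial α c) =
      C (MvPolynomial.aeval z (MvPolynomial.monomial α c)) * X ^ α.degree := by
    intro α c
    simp only [coordHom, MvPolynomial.aeval_monomial, Finsupp.prod, mul_pow, Finset.prod_mul_distrib,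
      map_mul, map_prod, map_pow, Finset.prod_pow_eq_pow_sum, Finsupp.degree]
    rw [mul_assoc]
    congr 1
  rw [a.as_sum]
  simp only [map_sum, Finset.sum_mul]
  refine Finset.sum_congr rfl fun α hα => ?_
  rw [h1]
  congr 2
  have := ha (MvPolynomial.mem_support_iff.1 hα)
  rw [← this, Finsupp.degree_eq_weight_one]
  rfl

/-- The extra variable records degree, so the range of `coordHom z` is a graded ring whatever
relations the `z j` satisfy. -/
lemma coeff_coordHom (P : MvPolynomial (Fin (N + 1)) K) (k : ℕ) :
    (coordHom z P).coeff k = MvPolynomial.aeval z (P.homogeneousComponent k) := by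
  conv_lhs => rw [← P.sum_homogeneousComponent, map_sum, finsetSum_coeff]
  have : ∀ i, (coordHom z (P.homogeneousComponent i)).coeff k =
      if i = k then MvPolynomial.aeval z (P.homogeneousComponent k) else 0 := by
    intro i
    rw [coordHom_of_isHomogeneous z (MvPolynomial.homogeneousComponent_isHomogeneous i P),
      coeff_C_mul_X_pow]
    split_ifs with h1 h2 h2
    · rw [h2]
    · exact absurd h1.symm h2
    · exact absurd h2.symm h1
    · rfl
  simp only [this, Finset.sum_ite_eq', Finset.mem_range]
  split_ifs with h
  · rfl
  · rw [MvPolynomial.homogeneousComponent_eq_zero _ _ (by omega), map_zero]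

/-- Determinant trick: multiplication by `v` preserves the nonzero ideal of elements of `B` of order
at least `D` in `X`, and this ideal is finitely generated because `B` is Noetherian. -/
lemma isIntegral_of_mul_coord_pow_mem (i₀ : Fin (N + 1)) (hz : z i₀ ≠ 0) (v : F[X])
    (h : ∀ j, ∃ d, v * (coordHom (K := K) z (MvPolynomial.X j)) ^ d ∈ (coordHom (K := K) z).range) :
    IsIntegral (coordHom (K := K) z).range v := by
  set B := (coordHom (K := K) z).range with hB
  have : Algebra.FiniteType K B :=
    Algebra.FiniteType.of_surjective (coordHom (K := K) z).rangeRestrict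
      (coordHom (K := K) z).rangeRestrict_surjective
  have : IsNoetherianRing B := Algebra.FiniteType.isNoetherianRing K B
  have hX : ∀ j, coordHom (K := K) z (MvPolynomial.X j) ∈ B := fun j => ⟨_, rfl⟩
  choose d₀ hd₀ using h
  let d := ∑ j, d₀ j
  have hd : ∀ j, v * coordHom (K := K) z (MvPolynomial.X j) ^ d ∈ B := by
    intro j
    have : d₀ j ≤ d := Finset.single_le_sum (f := d₀) (fun _ _ => Nat.zero_le _) (Finset.mem_univ j)
    obtain ⟨e, he⟩ := Nat.exists_eq_add_of_le this
    rw [he, pow_add, ← mul_assoc]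
    exact B.mul_mem (hd₀ j) (B.pow_mem (hX j) e)
  -- Pigeonhole: a monomial of degree at least `(N + 1) d` in `N + 1` variables is divisible by some
  -- `X j ^ d`, and `v` carries that power into `B`.
  let D := (N + 1) * d
  have hmon : ∀ (α : Fin (N + 1) →₀ ℕ) (c : K), D ≤ α.degree →
      v * coordHom z (MvPolynomial.monomial α c) ∈ B := by
    intro α c hα
    obtain ⟨j, -, hj⟩ : ∃ j ∈ Finset.univ, (fun _ => d) j ≤ α j := by
      apply Finset.exists_le_of_sum_le Finset.univ_nonempty
      rw [Finsupp.degree_eq_sum] at hα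
      simpa [D] using hα
    have : MvPolynomial.monomial α c = MvPolynomial.X j ^ d *
        MvPolynomial.monomial (α - Finsupp.single j d) c := by
      rw [MvPolynomial.X_pow_eq_monomial, MvPolynomial.monomial_mul, one_mul,
        add_tsub_cancel_of_le (Finsupp.single_le_iff.2 hj)]
    rw [this, map_mul, map_pow, ← mul_assoc]
    exact B.mul_mem (hd j) ⟨_, rfl⟩
  let I : Submodule B F[X] :=
    { carrier := {u | u ∈ B ∧ X ^ D ∣ u}
      add_mem' := fun h h' => ⟨B.add_mem h.1 h'.1, dvd_add h.2 h'.2⟩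
      zero_mem' := ⟨B.zero_mem, dvd_zero _⟩
      smul_mem' := fun b u h => ⟨B.mul_mem b.2 h.1, h.2.mul_left _⟩ }
  have hI : I.FG := by
    have h1 : IsNoetherian B (LinearMap.range (Algebra.linearMap B F[X])) := inferInstance
    exact isNoetherian_submodule.1 h1 I fun u hu => ⟨⟨u, hu.1⟩, rfl⟩
  refine isIntegral_of_smul_mem_submodule I ?_ hI v ?_
  · rw [Submodule.ne_bot_iff]
    refine ⟨coordHom (K := K) z (MvPolynomial.X i₀) ^ D, ⟨B.pow_mem (hX _) _, ?_⟩, ?_⟩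
    · simp only [coordHom, MvPolynomial.aeval_X, mul_pow]
      exact Dvd.intro_left _ rfl
    · simp only [coordHom, MvPolynomial.aeval_X]
      exact pow_ne_zero _ (mul_ne_zero (C_ne_zero.2 hz) X_ne_zero)
  · rintro u ⟨⟨P, rfl⟩, hu⟩
    refine ⟨?_, hu.mul_left _⟩
    change v * coordHom z P ∈ B
    rw [← P.sum_homogeneousComponent, map_sum, Finset.mul_sum]
    refine B.sum_mem fun k _ => ?_
    -- Components of degree below `D` may be nonzero polynomials, but their images vanish because `X
    -- ^ D` divides `u`.
    by_cases hk : k < D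
    · rw [coordHom_of_isHomogeneous z (MvPolynomial.homogeneousComponent_isHomogeneous k P),
        ← coeff_coordHom]
      have : (coordHom z P).coeff k = 0 := X_pow_dvd_iff.1 hu k hk
      rw [this]
      simp
    · rw [(P.homogeneousComponent k).as_sum, map_sum, Finset.mul_sum]
      refine B.sum_mem fun α hα => hmon α _ ?_
      have := MvPolynomial.homogeneousComponent_isHomogeneous k P (MvPolynomial.mem_support_iff.1 hα)
      rw [Finsupp.degree_eq_weight_one]
      exact (not_lt.1 hk).trans this.ge

/-- The elements `H g X ^ m` are integral over `B` and lie in its fraction field, so their `B`-span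
is finitely generated. They all have degree `m`, and the degree-zero part of `B` is `K`, so finite
generation over `B` becomes finite dimension over `K`. -/
lemma finite_of_isIntegral [CharZero K] (i₀ : Fin (N + 1)) (hz : z i₀ ≠ 0) (W : Submodule K F)
    (H : F) (hH : H ≠ 0) (m : ℕ) (h : ∀ g ∈ W, ∀ j, ∃ d,
      C (H * g) * X ^ m * (coordHom (K := K) z (MvPolynomial.X j)) ^ d ∈
        (coordHom (K := K) z).range) :
    Module.Finite K W := by
  set B := (coordHom (K := K) z).range with hB
  have : Algebra.FiniteType K B :=
    Algebra.FiniteType.of_surjective (coordHom (K := K) z).rangeRestrict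
      (coordHom (K := K) z).rangeRestrict_surjective
  let E := FractionRing F[X]
  have hinj : Function.Injective (algebraMap B E) := by
    rw [IsScalarTower.algebraMap_eq B F[X] E]
    exact (IsFractionRing.injective F[X] E).comp Subtype.val_injective
  have : FaithfulSMul B E := (faithfulSMul_iff_algebraMap_injective B E).2 hinj
  obtain ⟨M, hM, hM'⟩ := exists_isNoetherian_of_isIntegral K B E
  let ψ : F[X] →ₗ[B] E := (IsScalarTower.toAlgHom B F[X] E).toLinearMap
  let v : F → F[X] := fun g => C (H * g) * X ^ m
  have hv : v '' W ⊆ M.comap ψ := by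
    rintro _ ⟨g, hg, rfl⟩
    have hint := isIntegral_of_mul_coord_pow_mem z i₀ hz (v g) (h g hg)
    obtain ⟨d, hd⟩ := h g hg i₀
    refine hM' _ (hint.map (IsScalarTower.toAlgHom B F[X] E))
      ⟨coordHom (K := K) z (MvPolynomial.X i₀) ^ d, B.pow_mem ⟨_, rfl⟩ _⟩ ⟨_, hd⟩ ?_ ?_
    · rw [Ne, Subtype.ext_iff]
      simp only [coordHom, MvPolynomial.aeval_X]
      exact pow_ne_zero _ (mul_ne_zero (C_ne_zero.2 hz) X_ne_zero)
    · rw [IsScalarTower.algebraMap_apply B F[X] E, IsScalarTower.algebraMap_apply B F[X] E, mul_comm]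
      exact (map_mul (algebraMap F[X] E) _ _).symm
  have hN : IsNoetherian B (M.comap ψ) := by
    let χ : M.comap ψ →ₗ[B] M := ψ.restrict fun x hx => hx
    refine isNoetherian_of_injective χ fun x y hxy => ?_
    exact Subtype.ext (IsFractionRing.injective F[X] E (congrArg Subtype.val hxy))
  have hfg : (Submodule.span B (v '' W)).FG :=
    isNoetherian_submodule.1 hN _ (Submodule.span_le.2 hv)
  obtain ⟨t, htW, ht⟩ := Submodule.fg_span_iff_fg_span_finset_subset _ |>.1 hfg
  let T : Submodule K F := Submodule.span K ((fun u : F[X] => H⁻¹ * u.coeff m) '' t)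
  -- Divisibility by `X ^ m` is carried along so that only the constant term of `b : B`, a scalar of
  -- `K`, contributes to the coefficient of `X ^ m` in `b • u`.
  have key : ∀ u ∈ Submodule.span B (t : Set F[X]), X ^ m ∣ u ∧ H⁻¹ * u.coeff m ∈ T := by
    intro u hu
    induction hu using Submodule.span_induction with
    | mem u hu =>
      obtain ⟨g, -, rfl⟩ := htW hu
      exact ⟨Dvd.intro_left _ rfl, Submodule.subset_span ⟨_, hu, rfl⟩⟩
    | zero => exact ⟨dvd_zero _, by simp⟩
    | add u u' _ _ h h' =>
      refine ⟨dvd_add h.1 h'.1, ?_⟩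
      rw [coeff_add, mul_add]
      exact T.add_mem h.2 h'.2
    | smul b u _ h =>
      obtain ⟨⟨w, rfl⟩, hw⟩ := h
      obtain ⟨_, P, rfl⟩ := b
      have hs : (⟨_, P, rfl⟩ : B) • (X ^ m * w) = (coordHom z P * w) * X ^ m := by
        change coordHom z P * (X ^ m * w) = _
        ring
      refine ⟨?_, ?_⟩
      · rw [hs]; exact Dvd.intro_left _ rfl
      · have h0 : (coordHom z P).coeff 0 = algebraMap K F (MvPolynomial.coeff 0 P) := by
          rw [coeff_coordHom, MvPolynomial.homogeneousComponent_zero, MvPolynomial.aeval_C]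
        rw [mul_comm (X ^ m) w] at hw
        have e1 : ((coordHom z P * w) * X ^ m).coeff m =
            algebraMap K F (MvPolynomial.coeff 0 P) * w.coeff 0 := by
          rw [← h0, ← mul_coeff_zero]
          simpa using coeff_mul_X_pow (coordHom z P * w) m 0
        have e2 : (w * X ^ m).coeff m = w.coeff 0 := by
          simpa using coeff_mul_X_pow w m 0
        rw [e2] at hw
        rw [hs, e1, mul_left_comm, ← Algebra.smul_def]
        exact T.smul_mem _ hw
  have hWT : W ≤ T := by
    intro g hg
    have h1 : v g ∈ Submodule.span B (t : Set F[X]) := by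
      rw [← ht]
      exact Submodule.subset_span ⟨g, hg, rfl⟩
    have := (key _ h1).2
    have e : (v g).coeff m = H * g := by
      simp only [v, coeff_C_mul_X_pow, if_true]
    rwa [e, inv_mul_cancel_left₀ hH] at this
  have : FiniteDimensional K T :=
    FiniteDimensional.span_of_finite K (t.finite_toSet.image _)
  exact Submodule.finiteDimensional_of_le hWT

/-- The dehomogenized coordinate ring `K[z₀/z_j, …, z_N/z_j]`. -/
def chartSet (K : Type*) [Field K] [Algebra K F] (j : Fin (N + 1)) : Set F :=
  {y | ∃ (d : ℕ) (a : MvPolynomial (Fin (N + 1)) K), a.IsHomogeneous d ∧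
    y * z j ^ d = MvPolynomial.aeval z a}

/-- The numerators `b j` of the denominators on the separate charts are multiplied together into one
homogeneous form; its value at `z` is the `H` of `finite_of_isIntegral`, and its degree the `m`. -/
theorem finite_of_forall_mul_mem_chartSet [CharZero K] (i₀ : Fin (N + 1)) (hz : z i₀ ≠ 0)
    (W : Submodule K F) (h : ∀ j, z j ≠ 0 → ∃ y ∈ chartSet z K j, y ≠ 0 ∧
      ∀ g ∈ W, y * g ∈ chartSet z K j) : Module.Finite K W := by
  have h' : ∀ j, ∃ (m : ℕ) (b : MvPolynomial (Fin (N + 1)) K), b.IsHomogeneous m ∧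
      MvPolynomial.aeval z b ≠ 0 ∧ ∀ g ∈ W, ∃ (d : ℕ) (a : MvPolynomial (Fin (N + 1)) K),
        a.IsHomogeneous (m + d) ∧ MvPolynomial.aeval z b * g * z j ^ d = MvPolynomial.aeval z a := by
    intro j
    by_cases hj : z j = 0
    -- An empty chart imposes nothing: the exponent `d = 1` makes `z j ^ d` vanish, so `a = 0`
    -- serves.
    · refine ⟨0, 1, MvPolynomial.isHomogeneous_one _ _, by simp, fun g _ =>
        ⟨1, 0, MvPolynomial.isHomogeneous_zero _ _ _, by simp [hj]⟩⟩
    · obtain ⟨y, ⟨m, b, hb, hyb⟩, hy0, hy⟩ := h j hj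
      refine ⟨m, b, hb, ?_, fun g hg => ?_⟩
      · rw [← hyb]
        exact mul_ne_zero hy0 (pow_ne_zero _ hj)
      · obtain ⟨d, a, ha, hya⟩ := hy g hg
        refine ⟨d, MvPolynomial.X j ^ m * a, ?_, ?_⟩
        · simpa using ((MvPolynomial.isHomogeneous_X K j).pow m).mul ha
        · rw [map_mul, map_pow, MvPolynomial.aeval_X, ← hya, ← hyb]
          ring
  choose m b hb hb0 hW using h'
  have hprod : (∏ j, b j).IsHomogeneous (∑ j, m j) :=
    MvPolynomial.IsHomogeneous.prod _ _ _ fun j _ => hb j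
  refine finite_of_isIntegral z i₀ hz W (MvPolynomial.aeval z (∏ j, b j)) ?_ (∑ j, m j) ?_
  · rw [map_prod]
    exact Finset.prod_ne_zero_iff.2 fun j _ => hb0 j
  · intro g hg j
    obtain ⟨d, a, ha, hga⟩ := hW j g hg
    refine ⟨d, (∏ k ∈ Finset.univ.erase j, b k) * a, ?_⟩
    have h1 : (∏ k ∈ Finset.univ.erase j, b k).IsHomogeneous (∑ k ∈ Finset.univ.erase j, m k) :=
      MvPolynomial.IsHomogeneous.prod _ _ _ fun j _ => hb j
    have h2 := h1.mul ha
    rw [← add_assoc, Finset.sum_erase_add _ _ (Finset.mem_univ j)] at h2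
    change coordHom z _ = _
    rw [coordHom_of_isHomogeneous z h2, coordHom_of_isHomogeneous z (MvPolynomial.isHomogeneous_X K j),
      map_mul, ← hga, ← Finset.prod_erase_mul _ _ (Finset.mem_univ j), map_mul, MvPolynomial.aeval_X]
    simp only [map_mul, map_pow]
    ring

end Finiteness

end

section

/-! ### Standard charts of a projective variety -/

/-- Turns a factorisation of `U ⟶ Y ⟶ Spec R` through `Spec S` into an identity of ring maps into
`Γ(Y, U)`. -/
lemma ΓSpecIso_inv_appTop_map {Y : Scheme.{u}} (U : Y.Opens) {R S : CommRingCat.{u}}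
    (g : Y ⟶ Spec R) (h : (U : Scheme.{u}) ⟶ Spec S) (φ : R ⟶ S) (α : S ⟶ Γ(Y, U))
    (hg : U.ι ≫ g = h ≫ Spec.map φ)
    (hα : h.appTop = (Scheme.ΓSpecIso S).hom ≫ α ≫ U.topIso.inv) :
    (Scheme.ΓSpecIso R).inv ≫ g.appTop ≫ Y.presheaf.map (homOfLE (le_top : U ≤ ⊤)).op = φ ≫ α := by
  have h1 : g.appTop ≫ U.ι.appTop = (Spec.map φ).appTop ≫ h.appTop := by
    rw [← Scheme.Hom.comp_appTop, ← Scheme.Hom.comp_appTop, hg]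
  have h2 : U.ι.appTop ≫ U.topIso.hom = Y.presheaf.map (homOfLE (le_top : U ≤ ⊤)).op := by
    rw [Scheme.Opens.topIso_hom, Scheme.Hom.appTop, Scheme.Opens.ι_app]
    exact (Y.presheaf.map_comp _ _).symm
  rw [← h2, reassoc_of% h1, hα]
  simp only [Category.assoc, Iso.inv_hom_id, Category.comp_id]
  rw [← Scheme.ΓSpecIso_inv_naturality_assoc, Iso.inv_hom_id_assoc]

/-! ### Sections and scalars of `Proj` in its local rings -/

section Proj

open HomogeneousLocalization

variable {σ : Type*} {A : Type u} [CommRing A] [SetLike σ A] [AddSubgroupClass σ A]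
  (𝒜 : ℕ → σ) [GradedRing 𝒜]

lemma germ_awayToSection (g : A) (x : Proj 𝒜) (hx : x ∈ Proj.basicOpen 𝒜 g) (a : Away 𝒜 g) :
    (Proj 𝒜).presheaf.germ _ x hx (Proj.awayToSection 𝒜 g a) =
      (Proj.stalkIso 𝒜 x).inv (mapId 𝒜 (Submonoid.powers_le.mpr hx) a) :=
  ConcreteCategory.congr_hom (ProjectiveSpectrum.Proj.awayToSection_germ 𝒜 g x hx) a

lemma toSpecZero_appTop_map (g : A) {m : ℕ} (hg : g ∈ 𝒜 m) (hm : 0 < m) :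
    (Scheme.ΓSpecIso (.of (𝒜 0))).inv ≫ (Proj.toSpecZero 𝒜).appTop ≫
        (Proj 𝒜).presheaf.map (homOfLE (le_top : Proj.basicOpen 𝒜 g ≤ ⊤)).op =
        CommRingCat.ofHom (fromZeroRingHom 𝒜 _) ≫ Proj.awayToSection 𝒜 g := by
  refine ΓSpecIso_inv_appTop_map _ _ (Proj.basicOpenToSpec 𝒜 g) _ _ ?_ ?_
  · rw [← Proj.awayι_toSpecZero 𝒜 g hg hm, ← Proj.basicOpenIsoSpec_hom 𝒜 g hg hm,
      Proj.awayι, Category.assoc, Iso.hom_inv_id_assoc]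
  · exact Proj.basicOpenToSpec_app_top 𝒜 g

lemma germ_toSpecZero_appTop (g : A) {m : ℕ} (hg : g ∈ 𝒜 m) (hm : 0 < m) (x : Proj 𝒜)
    (hx : x ∈ Proj.basicOpen 𝒜 g) (c : 𝒜 0) :
    (Proj 𝒜).presheaf.germ ⊤ x (Opens.mem_top _)
      ((Proj.toSpecZero 𝒜).appTop ((Scheme.ΓSpecIso (.of (𝒜 0))).inv c)) =
      (Proj.stalkIso 𝒜 x).inv (fromZeroRingHom 𝒜 _ c) := by
  rw [← (Proj 𝒜).presheaf.germ_res_apply (homOfLE (le_top : Proj.basicOpen 𝒜 g ≤ ⊤)) x hx]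
  have h1 := ConcreteCategory.congr_hom (toSpecZero_appTop_map 𝒜 g hg hm) c
  refine (congrArg _ h1).trans ?_
  refine (germ_awayToSection 𝒜 g x hx _).trans ?_
  congr 1

lemma germ_toSpecZero_comp_appTop (g : A) {m : ℕ} (hg : g ∈ 𝒜 m) (hm : 0 < m) (x : Proj 𝒜)
    (hx : x ∈ Proj.basicOpen 𝒜 g) {R : CommRingCat.{u}} (φ : R ⟶ .of (𝒜 0)) (c : R) :
    (Proj 𝒜).presheaf.germ ⊤ x (Opens.mem_top _)
      ((Proj.toSpecZero 𝒜 ≫ Spec.map φ).appTop ((Scheme.ΓSpecIso R).inv c)) =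
      (Proj.stalkIso 𝒜 x).inv (fromZeroRingHom 𝒜 _ (φ c)) := by
  rw [← germ_toSpecZero_appTop 𝒜 g hg hm x hx]
  congr 1
  have : (Scheme.ΓSpecIso R).inv ≫ (Proj.toSpecZero 𝒜 ≫ Spec.map φ).appTop =
      φ ≫ (Scheme.ΓSpecIso _).inv ≫ (Proj.toSpecZero _).appTop := by
    rw [Scheme.Hom.comp_appTop, Scheme.ΓSpecIso_inv_naturality_assoc]
  exact ConcreteCategory.congr_hom this c

end Proj

/-! ### Ratios of homogeneous coordinates -/

section Coordinates

open HomogeneousLocalization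

lemma eval₂_mul_of_isHomogeneous {ι R B : Type*} [CommRing R] [CommRing B] (g : R →+* B) (v : ι → B) (u : B)
    {a : MvPolynomial ι R} {d : ℕ} (ha : a.IsHomogeneous d) :
    a.eval₂ g (fun k => v k * u) = a.eval₂ g v * u ^ d := by
  rw [MvPolynomial.eval₂_eq, MvPolynomial.eval₂_eq, Finset.sum_mul]
  refine Finset.sum_congr rfl fun α hα => ?_
  simp only [mul_pow, Finset.prod_mul_distrib, Finset.prod_pow_eq_pow_sum]
  have := ha (MvPolynomial.mem_support_iff.1 hα)
  rw [← this, mul_assoc, ← Finsupp.degree_apply, Finsupp.degree_eq_weight_one]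
  rfl

attribute [local instance] MvPolynomial.gradedAlgebra

variable {K : Type u} [Field K] {N : ℕ}
local notation "𝒢" => MvPolynomial.homogeneousSubmodule (Fin (N + 1)) K

variable (P : Ideal (MvPolynomial (Fin (N + 1)) K)) [P.IsPrime]

/-- The fraction `x_k / x_i`. -/
def coordRatio (i : Fin (N + 1)) (h : MvPolynomial.X i ∉ P) (k : Fin (N + 1)) : AtPrime 𝒢 P :=
  .mk ⟨1, ⟨MvPolynomial.X k, MvPolynomial.isHomogeneous_X K k⟩,
    ⟨MvPolynomial.X i, MvPolynomial.isHomogeneous_X K i⟩, h⟩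

/-- Both sides are `a / x_i ^ n`. This change of chart expresses a function on chart `j` through the
coordinates of chart `i`. -/
lemma mapId_awayMk_mul_coordRatio_pow (i j : Fin (N + 1))
    (hi : MvPolynomial.X i ∉ P) (hj : MvPolynomial.X j ∉ P) (n : ℕ)
    (a : MvPolynomial (Fin (N + 1)) K) (ha : a ∈ 𝒢 (n • 1)) :
    mapId 𝒢 (P := Submonoid.powers (MvPolynomial.X j)) (Q := P.primeCompl) (Submonoid.powers_le.mpr hj)
      (Away.mk 𝒢 (MvPolynomial.isHomogeneous_X K j) n a ha) *
      coordRatio P i hi j ^ n =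
      a.eval₂ ((fromZeroRingHom 𝒢 _).comp (algebraMap K (𝒢 0))) (coordRatio P i hi) := by
  apply val_injective
  let u : Localization.AtPrime P := Localization.mk 1 ⟨MvPolynomial.X i, hi⟩
  have h1 : (a.eval₂ ((fromZeroRingHom 𝒢 _).comp (algebraMap K (𝒢 0))) (coordRatio P i hi)).val =
      algebraMap _ (Localization.AtPrime P) a * u ^ n := by
    change algebraMap (AtPrime 𝒢 P) (Localization.AtPrime P) _ = _
    rw [MvPolynomial.hom_eval₂]
    have h2 : (a.eval₂ ((algebraMap (MvPolynomial (Fin (N + 1)) K) (Localization.AtPrime P)).comp MvPolynomial.C)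
       fun k => algebraMap (MvPolynomial (Fin (N + 1)) K) (Localization.AtPrime P) (MvPolynomial.X k)) =
        algebraMap _ (Localization.AtPrime P) a := by
      rw [← MvPolynomial.hom_eval₂, MvPolynomial.eval₂_eta]
    rw [← h2, ← eval₂_mul_of_isHomogeneous _ _ u (d := n) (by simpa using ha)]
    congr 1
    ext k
    simp [u, coordRatio, ← Localization.mk_one_eq_algebraMap, Localization.mk_mul,
      HomogeneousLocalization.algebraMap_apply]
  have h3 : (mapId 𝒢 (P := Submonoid.powers (MvPolynomial.X j)) (Q := P.primeCompl)
      (Submonoid.powers_le.mpr hj)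
      (Away.mk 𝒢 (MvPolynomial.isHomogeneous_X K j) n a ha)).val =
      Localization.mk a ((⟨MvPolynomial.X j, hj⟩ : P.primeCompl) ^ n) := rfl
  rw [h1, val_mul, val_pow, h3]
  simp only [val_mk, coordRatio, u, ← Localization.mk_one_eq_algebraMap,
    Localization.mk_mul, Localization.mk_pow]
  rw [Localization.mk_eq_mk_iff, Localization.r_iff_exists]
  refine ⟨1, ?_⟩
  simp
  ring

lemma notMem_of_isUnit_coordRatio (i j : Fin (N + 1)) (hi : MvPolynomial.X i ∉ P)
    (h : IsUnit (coordRatio P i hi j)) : MvPolynomial.X j ∉ P := by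
  rw [← isUnit_iff_isUnit_val] at h
  rw [coordRatio, val_mk, Localization.mk_eq_mk'] at h
  exact (IsLocalization.AtPrime.isUnit_mk'_iff (Localization.AtPrime P) P _ _).1 h

lemma coordRatio_self (i : Fin (N + 1)) (hi : MvPolynomial.X i ∉ P) : coordRatio P i hi i = 1 := by
  apply val_injective
  rw [coordRatio, val_mk, val_one]
  exact Localization.mk_self (⟨_, hi⟩ : P.primeCompl)

end Coordinates

/-! ### Affine charts and coordinates in the function field -/

section Charts

open HomogeneousLocalization

attribute [local instance] MvPolynomial.gradedAlgebra
variable {K : Type u} [Field K] {X : Scheme.{u}}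

/-- The scalars of the function field of a variety. -/
def functionFieldScalars [IsIntegral X] (f : X ⟶ Spec (.of K)) : K →+* X.functionField :=
  (X.presheaf.germ ⊤ (genericPoint X) (Opens.mem_top _)).hom.comp (scalars f)

lemma scalars_comp {Y : Scheme.{u}} (i : X ⟶ Y) (f : Y ⟶ Spec (.of K)) (c : K) :
    scalars (i ≫ f) c = i.appTop (scalars f c) := by
  rw [scalars, Scheme.Hom.comp_appTop]
  rfl

variable {N : ℕ}
local notation "𝒢" => MvPolynomial.homogeneousSubmodule (Fin (N + 1)) K

lemma X_mem_homogeneousSubmodule (i : Fin (N + 1)) : MvPolynomial.X i ∈ 𝒢 1 :=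
  MvPolynomial.isHomogeneous_X K i

lemma germ_scalars_projectiveSpace (i : Fin (N + 1)) (x : projectiveSpace K N)
    (hx : x ∈ Proj.basicOpen 𝒢 (MvPolynomial.X i)) (c : K) :
    (projectiveSpace K N).presheaf.germ ⊤ x (Opens.mem_top _) (scalars (projectiveSpaceToSpec K N) c) =
      (Proj.stalkIso 𝒢 x).inv (fromZeroRingHom 𝒢 _ (algebraMap K (𝒢 0) c)) :=
  germ_toSpecZero_comp_appTop 𝒢 (MvPolynomial.X i)
    (X_mem_homogeneousSubmodule i) one_pos x hx (R := .of K) (CommRingCat.ofHom (algebraMap K (𝒢 0))) c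

lemma exists_mem_basicOpen_X (x : projectiveSpace K N) :
    ∃ i, x ∈ Proj.basicOpen 𝒢 (MvPolynomial.X i) := by
  have := Proj.iSup_basicOpen_eq_top' 𝒢
    (fun i => MvPolynomial.X i) (fun i => ⟨1, X_mem_homogeneousSubmodule i⟩) (by
      rw [eq_top_iff]
      rintro a -
      induction a using MvPolynomial.induction_on with
      | C c =>
        exact Subalgebra.algebraMap_mem (Algebra.adjoin (𝒢 0) _) (algebraMap K (𝒢 0) c)
      | add p q hp hq => exact add_mem hp hq
      | mul_X p i hp => exact mul_mem hp (Algebra.subset_adjoin ⟨i, rfl⟩))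
  exact Opens.mem_iSup.1 (this.ge (Set.mem_univ x))

lemma germ_app_awayToSection (i : X ⟶ projectiveSpace K N) (x : X) (j : Fin (N + 1))
    (hj : x ∈ i ⁻¹ᵁ Proj.basicOpen 𝒢 (MvPolynomial.X j)) (b) :
    X.presheaf.germ _ x hj (i.app _ (Proj.awayToSection 𝒢 (MvPolynomial.X j) b)) =
      i.stalkMap x ((Proj.stalkIso 𝒢 (i x)).inv (mapId 𝒢 (Submonoid.powers_le.mpr hj) b)) := by
  rw [← germ_awayToSection 𝒢 _ (i x) hj]
  exact (Scheme.Hom.germ_stalkMap_apply i _ x hj _).symm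

lemma germ_scalars_comp (i : X ⟶ projectiveSpace K N) (x : X) (c : K) :
    X.presheaf.germ ⊤ x (Opens.mem_top _) (scalars (i ≫ projectiveSpaceToSpec K N) c) =
      i.stalkMap x ((Proj.stalkIso 𝒢 (i x)).inv (fromZeroRingHom 𝒢 _ (algebraMap K (𝒢 0) c))) := by
  obtain ⟨j, hj⟩ := exists_mem_basicOpen_X (i x)
  rw [← germ_scalars_projectiveSpace j _ hj, Scheme.Hom.germ_stalkMap_apply, scalars_comp]
  rfl

instance isPrime_toIdeal (x : projectiveSpace K N) : x.asHomogeneousIdeal.toIdeal.IsPrime :=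
  x.isPrime

/-- The homomorphism from the local ring of `ℙ^N` at the image of the generic point of `X` to the
function field of `X`. -/
def toFunctionField [IsIntegral X] (i : X ⟶ projectiveSpace K N) :
    AtPrime 𝒢 (i (genericPoint X)).asHomogeneousIdeal.toIdeal →+* X.functionField :=
  ((Proj.stalkIso 𝒢 (i (genericPoint X))).inv ≫ i.stalkMap (genericPoint X)).hom

/-- Locality turns nonvanishing of `x_j / x_i` in the function field into invertibility at the image
of the generic point, which places the generic point in chart `j`. -/
instance [IsIntegral X] (i : X ⟶ projectiveSpace K N) : IsLocalHom (toFunctionField i) := by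
  have h1 : IsLocalHom (Proj.stalkIso 𝒢 (i (genericPoint X))).inv.hom :=
    ⟨fun a ha => by
      have := ha.map (Proj.stalkIso 𝒢 (i (genericPoint X))).hom.hom
      rwa [← CommRingCat.comp_apply, Iso.inv_hom_id] at this⟩
  have h2 : IsLocalHom (i.stalkMap (genericPoint X)).hom := inferInstance
  exact RingHom.isLocalHom_comp (i.stalkMap (genericPoint X)).hom
    (Proj.stalkIso 𝒢 (i (genericPoint X))).inv.hom

lemma toFunctionField_comp [IsIntegral X] (i : X ⟶ projectiveSpace K N) :
    (toFunctionField i).comp ((fromZeroRingHom 𝒢 _).comp (algebraMap K (𝒢 0))) =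
      functionFieldScalars (i ≫ projectiveSpaceToSpec K N) :=
  RingHom.ext fun c => (germ_scalars_comp i (genericPoint X) c).symm

/-- The function `x_j / x_k` on `X`. -/
def coordFun [IsIntegral X] (i : X ⟶ projectiveSpace K N) (k : Fin (N + 1))
    (hk : MvPolynomial.X k ∉ (i (genericPoint X)).asHomogeneousIdeal.toIdeal) (j : Fin (N + 1)) :
    X.functionField :=
  toFunctionField i (coordRatio _ k hk j)

/-- Take `z j = x_j / x_{i₀}`, with `x_{i₀}` nonzero at the generic point, and the traces of the
standard charts. A closed immersion is surjective on sections over affine opens, so each function on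
a trace comes from a fraction `a / x_j ^ n`. -/
theorem exists_charts [IsIntegral X] (f : X ⟶ Spec (.of K)) (hf : IsProjective f) :
    letI := (functionFieldScalars f).toAlgebra
    ∃ (N : ℕ) (z : Fin (N + 1) → X.functionField) (i₀ : Fin (N + 1)) (U : Fin (N + 1) → X.Opens),
      z i₀ ≠ 0 ∧ (∀ j, IsAffineOpen (U j)) ∧ (∀ x, ∃ j, x ∈ U j) ∧
      (∀ j, z j ≠ 0 → genericPoint X ∈ U j) ∧
      ∀ j (h : genericPoint X ∈ U j) (a : Γ(X, U j)),
        X.presheaf.germ (U j) (genericPoint X) h a ∈ chartSet z K j := by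
  let := (functionFieldScalars f).toAlgebra
  obtain ⟨N, i, hi, hif⟩ := hf
  obtain ⟨i₀, h₀'⟩ := exists_mem_basicOpen_X (i (genericPoint X))
  have h₀ : MvPolynomial.X i₀ ∉ (i (genericPoint X)).asHomogeneousIdeal.toIdeal := h₀'
  have hψ := toFunctionField_comp i
  rw [hif] at hψ
  have hX := X_mem_homogeneousSubmodule (K := K) (N := N)
  refine ⟨N, coordFun i i₀ h₀, i₀,
    fun j => i ⁻¹ᵁ Proj.basicOpen (MvPolynomial.homogeneousSubmodule _ K) (MvPolynomial.X j), ?_, fun j => ?_, fun x => ?_,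
    fun j hj => ?_, fun j h a => ?_⟩
  · intro h
    have h1 := congrArg (toFunctionField i) (coordRatio_self _ i₀ h₀)
    exact one_ne_zero ((map_one (toFunctionField i)).symm.trans (h1.symm.trans h))
  · exact (Proj.isAffineOpen_basicOpen _ _ (hX j) one_pos).preimage i
  · exact exists_mem_basicOpen_X (i x)
  · exact notMem_of_isUnit_coordRatio _ i₀ j h₀
      ((isUnit_map_iff (toFunctionField i) _).1 (isUnit_iff_ne_zero.2 hj))
  · obtain ⟨b, rfl⟩ := i.app_surjective _ (Proj.isAffineOpen_basicOpen _ _ (hX j) one_pos) a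
    obtain ⟨b, rfl⟩ := (ConcreteCategory.bijective_of_isIso
      (Proj.basicOpenIsoAway _ _ (hX j) one_pos).hom).2 b
    obtain ⟨n, a, ha, rfl⟩ := Away.mk_surjective _ (hX j) b
    refine ⟨n, a, by simpa using ha, ?_⟩
    have h2 := germ_app_awayToSection i (genericPoint X) j h (Away.mk _ (hX j) n a ha)
    have h3 := congrArg (toFunctionField i) (mapId_awayMk_mul_coordRatio_pow _ i₀ j h₀ h n a ha)
    rw [map_mul, map_pow, MvPolynomial.hom_eval₂, hψ] at h3
    exact (congrArg (· * _) h2).trans h3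

end Charts

end

section

variable {X : Scheme.{u}} {M N : X.Modules}

/-! ### Coefficients with respect to a generator -/

/-- The isomorphism `𝒪(U) ≃ M(U)` given by a generator. -/
def IsGenerator.equiv {U : X.Opens} {e : Γ(M, U)} (he : IsGenerator M e) :
    Γ(X, U) ≃ₗ[Γ(X, U)] Γ(M, U) :=
  LinearEquiv.ofBijective (LinearMap.toSpanSingleton Γ(X, U) Γ(M, U) e) (by
    have := he U le_rfl
    simp only [res_self] at this
    exact this)

/-- The coefficient of a section with respect to a generator. -/
def IsGenerator.coeff {U : X.Opens} {e : Γ(M, U)} (he : IsGenerator M e) :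
    Γ(M, U) →ₗ[Γ(X, U)] Γ(X, U) :=
  he.equiv.symm.toLinearMap

lemma IsGenerator.coeff_smul {U : X.Opens} {e : Γ(M, U)} (he : IsGenerator M e) (s : Γ(M, U)) :
    he.coeff s • e = s :=
  he.equiv.apply_symm_apply s

lemma IsGenerator.coeff_eq_iff {U : X.Opens} {e : Γ(M, U)} (he : IsGenerator M e) {s : Γ(M, U)}
    {a : Γ(X, U)} : he.coeff s = a ↔ s = a • e :=
  he.equiv.symm_apply_eq

lemma IsGenerator.coeff_res {U V : X.Opens} {e : Γ(M, U)} (he : IsGenerator M e) (h : V ≤ U)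
    (s : Γ(M, U)) : (he.res h).coeff (Terracini.res M h s) = resFun h (he.coeff s) := by
  rw [IsGenerator.coeff_eq_iff, ← res_smul, he.coeff_smul]

lemma IsGenerator.coeff_eq_mul {U : X.Opens} {e e' : Γ(M, U)} (he : IsGenerator M e)
    (he' : IsGenerator M e') (s : Γ(M, U)) : he'.coeff s = he.coeff s * he'.coeff e := by
  rw [IsGenerator.coeff_eq_iff, mul_smul, he'.coeff_smul, he.coeff_smul]

lemma IsGenerator.isUnit_coeff {U : X.Opens} {e e' : Γ(M, U)} (he : IsGenerator M e)
    (he' : IsGenerator M e') : IsUnit (he'.coeff e) := by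
  refine IsUnit.of_mul_eq_one (he.coeff e') ?_
  rw [mul_comm, ← he.coeff_eq_mul he', IsGenerator.coeff_eq_iff, one_smul]

/-! ### Finiteness of the space of sections of a line bundle -/

section Finite

variable [IsIntegral X]

lemma genericPoint_mem {U : X.Opens} {x : X} (hx : x ∈ U) : genericPoint X ∈ U :=
  (genericPoint_specializes x).mem_open U.2 hx

lemma germ_genericPoint_resFun {U V : X.Opens} (h : V ≤ U) (hV : genericPoint X ∈ V) (a : Γ(X, U)) :
    X.presheaf.germ V (genericPoint X) hV (resFun h a) = X.presheaf.germ U _ (h hV) a :=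
  X.presheaf.germ_res_apply (homOfLE h) _ hV a

/-- The rational function `y` is regular on `U`. -/
def IsRegularOn (y : X.functionField) (U : X.Opens) : Prop :=
  ∃ (h : genericPoint X ∈ U) (a : Γ(X, U)), X.presheaf.germ U _ h a = y

lemma IsRegularOn.mono {y : X.functionField} {U V : X.Opens} (h : IsRegularOn y U) (hVU : V ≤ U)
    (hV : genericPoint X ∈ V) : IsRegularOn y V := by
  obtain ⟨h, a, rfl⟩ := h
  exact ⟨hV, resFun hVU a, germ_genericPoint_resFun hVU hV a⟩

lemma IsRegularOn.mul {y z : X.functionField} {U : X.Opens} (hy : IsRegularOn y U)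
    (hz : IsRegularOn z U) : IsRegularOn (y * z) U := by
  obtain ⟨h, a, rfl⟩ := hy
  obtain ⟨h, b, rfl⟩ := hz
  exact ⟨h, a * b, map_mul _ _ _⟩

/-- On an integral scheme sections are determined by their generic germs, so local representatives
of `y` glue. -/
lemma isRegularOn_of_cover {y : X.functionField} {U : X.Opens} (hU : genericPoint X ∈ U)
    (h : ∀ x ∈ U, ∃ V : X.Opens, x ∈ V ∧ IsRegularOn y (U ⊓ V)) : IsRegularOn y U := by
  choose V hxV hV a ha using h
  obtain ⟨t, ht, -⟩ := X.sheaf.existsUnique_gluing' (fun x : U => U ⊓ V x.1 x.2) U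
    (fun x => homOfLE inf_le_left) (fun x hxU => Opens.mem_iSup.2 ⟨⟨x, hxU⟩, hxU, hxV x hxU⟩)
    (fun x => a x.1 x.2) (fun x x' => by
      have hg : genericPoint X ∈ (U ⊓ V x.1 x.2) ⊓ (U ⊓ V x'.1 x'.2) := ⟨hV _ _, hV _ _⟩
      apply germ_injective_of_isIntegral X _ hg
      exact (germ_genericPoint_resFun inf_le_left hg _).trans ((ha _ _).trans
        ((ha _ _).symm.trans (germ_genericPoint_resFun inf_le_right hg _).symm)))
  refine ⟨hU, t, ?_⟩
  refine (germ_genericPoint_resFun (inf_le_left : U ⊓ V _ hU ≤ U) (hV _ hU) t).symm.trans ?_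
  rw [← ha _ hU]
  exact congrArg _ (ht ⟨_, hU⟩)

variable {K : Type u} [Field K] [CharZero K]

lemma exists_mul_isRegularOn {U : X.Opens} (hU : IsAffineOpen U) (hξ : genericPoint X ∈ U)
    (y : X.functionField) : ∃ h : X.functionField, h ≠ 0 ∧ IsRegularOn h U ∧ IsRegularOn (h * y) U := by
  have : Nonempty U := ⟨⟨_, hξ⟩⟩
  have := functionField_isFractionRing_of_isAffineOpen X U hU
  obtain ⟨a, b, hb, rfl⟩ := IsFractionRing.div_surjective (A := Γ(X, U)) y
  have hb0 : algebraMap Γ(X, U) X.functionField b ≠ 0 := by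
    simpa using nonZeroDivisors.ne_zero hb
  refine ⟨algebraMap Γ(X, U) X.functionField b, hb0, ⟨hξ, b, rfl⟩, ⟨hξ, a, ?_⟩⟩
  rw [mul_div_cancel₀ _ hb0]
  rfl

/-- A trivialisation at the generic point embeds `Γ(L)` in the function field. Finitely many
trivialisations cover `X`, so the poles of the image are bounded by finitely many transition
functions. -/
theorem finite_sections (f : X ⟶ Spec (.of K)) (hf : IsProjective f) {L : X.Modules}
    (hL : HasLocalGenerators L) :
    letI : Module K Γ(L, ⊤) := Module.compHom _ (scalars f)
    Module.Finite K Γ(L, ⊤) := by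
  let : Module K Γ(L, ⊤) := Module.compHom _ (scalars f)
  let := (functionFieldScalars f).toAlgebra
  obtain ⟨N, z, i₀, U, hz, hU, hcov, hgen, hchart⟩ := exists_charts f hf
  have hcomp : CompactSpace X := by
    refine ⟨?_⟩
    have h1 : (Set.univ : Set X) = ⋃ j, (U j : Set X) := by
      ext x
      simpa using hcov x
    rw [h1]
    exact isCompact_iUnion fun j => (hU j).isCompact
  choose V hV e he using hL
  obtain ⟨T, hT⟩ := CompactSpace.elim_nhds_subcover (fun x => (V x : Set X))
    fun x => (V x).2.mem_nhds (hV x)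
  have hVξ : ∀ x, genericPoint X ∈ V x := fun x => genericPoint_mem (hV x)
  let g : ∀ x, Γ(L, ⊤) → X.functionField := fun x s =>
    X.presheaf.germ (V x) _ (hVξ x) ((he x).coeff (res L le_top s))
  have hγ : ∀ x, ∃ γ : X.functionField, γ ≠ 0 ∧ ∀ s, g x s = g (genericPoint X) s * γ := by
    intro x
    have hW : genericPoint X ∈ V x ⊓ V (genericPoint X) := ⟨hVξ _, hVξ _⟩
    have h1 := (he x).res (inf_le_left : V x ⊓ V (genericPoint X) ≤ V x)
    have h2 := (he (genericPoint X)).res (inf_le_right : V x ⊓ V (genericPoint X) ≤ _)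
    refine ⟨X.presheaf.germ _ _ hW (h1.coeff _), ((h2.isUnit_coeff h1).map
      (X.presheaf.germ _ _ hW).hom).ne_zero, fun s => ?_⟩
    simp only [g]
    rw [← germ_genericPoint_resFun inf_le_left hW,
      ← germ_genericPoint_resFun (inf_le_right : V x ⊓ V (genericPoint X) ≤ _) hW,
      ← IsGenerator.coeff_res, ← IsGenerator.coeff_res, res_res, res_res, ← map_mul]
    exact congrArg _ (h2.coeff_eq_mul h1 _)
  choose γ hγ0 hγ using hγ
  let φ : Γ(L, ⊤) →ₗ[K] X.functionField :=
    { toFun := g (genericPoint X)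
      map_add' := fun s t => by simp only [g, map_add]
      map_smul' := fun c s => by
        have h1 : c • s = scalars f c • s := rfl
        simp only [g, h1, res_smul, map_smul, smul_eq_mul, map_mul]
        rw [germ_genericPoint_resFun]
        rfl }
  have hinj : Function.Injective φ := by
    rw [injective_iff_map_eq_zero]
    intro s hs
    refine eq_of_locally_eq L s 0 fun x _ => ⟨V x, le_top, hV x, ?_⟩
    have h1 : g x s = 0 := by
      rw [hγ]
      exact mul_eq_zero_of_left hs _
    rw [map_zero, ← (he x).coeff_smul (res L le_top s),
      germ_injective_of_isIntegral X _ (hVξ x) (h1.trans (map_zero _).symm), zero_smul]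
  have : Module.Finite K (LinearMap.range φ) := by
    refine finite_of_forall_mul_mem_chartSet z i₀ hz _ fun j hj => ?_
    have hξ := hgen j hj
    choose h hh0 hh hhγ using fun k => exists_mul_isRegularOn (hU j) hξ (γ k)⁻¹
    have hprod : ∀ T' : Finset X, IsRegularOn (∏ k ∈ T', h k) (U j) := fun T' =>
      Finset.prod_induction _ (fun y => IsRegularOn y (U j)) (fun _ _ h1 h2 => h1.mul h2)
        ⟨hξ, 1, map_one _⟩ fun k _ => hh k
    have key : ∀ y, IsRegularOn y (U j) → y ∈ chartSet z K j := by
      rintro y ⟨_, a, rfl⟩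
      exact hchart j hξ a
    refine ⟨∏ k ∈ T, h k, key _ (hprod T), Finset.prod_ne_zero_iff.2 fun k _ => hh0 k, ?_⟩
    rintro _ ⟨s, rfl⟩
    refine key _ (isRegularOn_of_cover hξ fun x _ => ?_)
    obtain ⟨k, hk, hxk⟩ := Set.mem_iUnion₂.1 (hT.ge (Set.mem_univ x))
    refine ⟨V k, hxk, ?_⟩
    classical
    -- On `U j ⊓ V k` the section has regular coefficient `g k s = φ s * γ k`; the factor `h k`
    -- clears the poles of `(γ k)⁻¹`, and the other factors are regular.
    have h1 : (∏ k ∈ T, h k) * φ s = (∏ k' ∈ T.erase k, h k') * (h k * (γ k)⁻¹) * g k s := by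
      rw [hγ, ← Finset.prod_erase_mul T h hk]
      change _ * g (genericPoint X) s = _
      field_simp [hγ0 k]
    rw [h1]
    exact (((hprod _).mul (hhγ k)).mono inf_le_left ⟨hξ, hVξ k⟩).mul
      (IsRegularOn.mono ⟨hVξ k, _, rfl⟩ inf_le_right ⟨hξ, hVξ k⟩)
  exact Module.Finite.equiv (LinearEquiv.ofInjective φ hinj).symm

end Finite

end

section

variable {X : Scheme.{u}}

/-! ### Ideals of points and double points -/

lemma mem_primeIdealOf_iff {U : X.Opens} (hU : IsAffineOpen U) {p : X} (hp : p ∈ U) (a : Γ(X, U)) :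
    a ∈ (hU.primeIdealOf ⟨p, hp⟩).asIdeal ↔ p ∉ X.basicOpen a := by
  rw [hU.primeIdealOf_eq_map_closedPoint, X.mem_basicOpen a p hp]
  rfl

/-- The closure of `p` meets `U` in the closure of `p` in `U`, whose vanishing ideal is the prime of
`p`. -/
lemma ideal_point_of_mem {p : X} {U : X.Opens} (hU : IsAffineOpen U) (hp : p ∈ U) :
    (point p).ideal ⟨U, hU⟩ = (hU.primeIdealOf ⟨p, hp⟩).asIdeal := by
  have h1 : hU.fromSpec ⁻¹' (Closeds.closure {p} : Closeds X) =
      closure {hU.primeIdealOf ⟨p, hp⟩} := by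
    have := hU.fromSpec.isOpenEmbedding.isOpenMap.preimage_closure_eq_closure_preimage
      hU.fromSpec.continuous {p}
    refine Eq.trans this ?_
    congr 1
    ext x
    exact ⟨fun h => hU.fromSpec.isOpenEmbedding.injective
      (Eq.trans h (hU.fromSpec_primeIdealOf ⟨p, hp⟩).symm),
      fun h => (congrArg hU.fromSpec h).trans (hU.fromSpec_primeIdealOf ⟨p, hp⟩)⟩
  refine (congrArg PrimeSpectrum.vanishingIdeal h1).trans ?_
  rw [PrimeSpectrum.vanishingIdeal_closure, PrimeSpectrum.vanishingIdeal_singleton]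

lemma mem_ideal_point_iff {p : X} {U : X.affineOpens} (hp : p ∈ U.1) (a : Γ(X, U.1)) :
    a ∈ (point p).ideal U ↔ p ∉ X.basicOpen a := by
  rw [← mem_primeIdealOf_iff U.2 hp]
  exact Iff.of_eq (congrArg (a ∈ ·) (ideal_point_of_mem U.2 hp))

lemma ideal_point_of_notMem {p : X} (U : X.affineOpens) (hp : p ∉ U.1) :
    (point p).ideal U = ⊤ := by
  have hU : IsAffineOpen U.1 := U.2
  have h1 : hU.fromSpec ⁻¹' (Closeds.closure {p} : Closeds X) = ∅ := by
    rw [Set.eq_empty_iff_forall_notMem]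
    intro x hx
    have h2 : hU.fromSpec x ∈ U.1 := by
      have := Set.mem_range_self (f := hU.fromSpec) x
      rwa [hU.range_fromSpec] at this
    obtain ⟨y, hy, rfl⟩ := mem_closure_iff.1 hx U.1 U.1.2 h2
    exact hp hy
  exact (congrArg PrimeSpectrum.vanishingIdeal h1).trans PrimeSpectrum.vanishingIdeal_empty

lemma ideal_points (S : Finset X) (U : X.affineOpens) :
    (points S).ideal U = ⨅ p ∈ S, (point p).ideal U := by
  have := Scheme.IdealSheafData.ideal_biInf (fun p : X => point p) S.finite_toSet
  simp only [Finset.mem_coe] at this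
  rw [points, this]
  simp only [iInf_apply]

lemma ideal_doublePoints (S : Finset X) (U : X.affineOpens) :
    (doublePoints S).ideal U = ⨅ p ∈ S, (point p).ideal U ^ 2 := by
  have := Scheme.IdealSheafData.ideal_biInf (fun p : X => doublePoint p) S.finite_toSet
  simp only [Finset.mem_coe] at this
  rw [doublePoints, this]
  simp only [iInf_apply, doublePoint, Scheme.IdealSheafData.ideal_pow, Pi.pow_apply]

lemma ideal_doublePoint (p : X) (U : X.affineOpens) :
    (doublePoint p).ideal U = (point p).ideal U ^ 2 := rfl

section

variable {S : Finset X} {U : X.affineOpens}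

lemma iInf_eq_of_forall_mem {I : X → Ideal Γ(X, U)} {p : X} (hp : p ∈ S)
    (h : ∀ q ∈ S, q ≠ p → I q = ⊤) : ⨅ q ∈ S, I q = I p := by
  refine le_antisymm (iInf₂_le p hp) (le_iInf₂ fun q hq => ?_)
  by_cases hqp : q = p
  · rw [hqp]
  · rw [h q hq hqp]
    exact le_top

lemma ideal_points_eq {p : X} (hp : p ∈ S) (h : ∀ q ∈ S, q ∈ U.1 → q = p) :
    (points S).ideal U = (point p).ideal U := by
  rw [ideal_points]
  exact iInf_eq_of_forall_mem hp fun q hq hqp => ideal_point_of_notMem U fun hqU => hqp (h q hq hqU)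

lemma ideal_doublePoints_eq {p : X} (hp : p ∈ S) (h : ∀ q ∈ S, q ∈ U.1 → q = p) :
    (doublePoints S).ideal U = (point p).ideal U ^ 2 := by
  rw [ideal_doublePoints]
  refine iInf_eq_of_forall_mem (I := fun q => (point q).ideal U ^ 2) hp fun q hq hqp => ?_
  rw [ideal_point_of_notMem U fun hqU => hqp (h q hq hqU), Ideal.top_pow]

lemma ideal_points_inf_doublePoint {p : X} (hp : p ∈ S) (h : ∀ q ∈ S, q ∈ U.1 → q = p) :
    (points S ⊓ doublePoint p).ideal U = (point p).ideal U ^ 2 := by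
  rw [Scheme.IdealSheafData.ideal_inf, Pi.inf_apply, ideal_points_eq hp h, ideal_doublePoint]
  exact inf_eq_right.2 (Ideal.pow_le_self two_ne_zero)

lemma ideal_points_inf_doublePoint_of_ne {p q : X} (hp : p ∈ S) (hq : q ∈ S)
    (h : ∀ q ∈ S, q ∈ U.1 → q = p) (hqp : q ≠ p) :
    (points S ⊓ doublePoint q).ideal U = (point p).ideal U := by
  rw [Scheme.IdealSheafData.ideal_inf, Pi.inf_apply, ideal_points_eq hp h, ideal_doublePoint,
    ideal_point_of_notMem U fun hqU => hqp (h q hq hqU), Ideal.top_pow, inf_top_eq]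

end

/-- If the ideal of `Z` is locally trivial away from `S`, then `Z` is supported on `S`. -/
lemma support_subset_of_ideal_eq_top {S : Finset X} (hS : IsClosed (S : Set X))
    {Z : X.IdealSheafData} (h : ∀ U : X.affineOpens, (∀ p ∈ S, p ∉ U.1) → Z.ideal U = ⊤) :
    (Z.support : Set X) ⊆ S := by
  intro x hx
  by_contra hxS
  obtain ⟨_, ⟨U, hU, rfl⟩, hxU, hUS⟩ :=
    X.isBasis_affineOpens.exists_subset_of_mem_open (show x ∈ (S : Set X)ᶜ from hxS) hS.isOpen_compl
  have h1 := (Z.mem_support_iff_of_mem (U := ⟨U, hU⟩) hxU).1 hx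
  rw [h ⟨U, hU⟩ fun p hp hpU => hUS hpU hp] at h1
  have h2 := (X.mem_zeroLocus_iff _ x).1 h1 (1 : Γ(X, U)) (Submodule.mem_top)
  rw [Scheme.basicOpen_of_isUnit _ isUnit_one] at h2
  exact h2 hxU

lemma support_doublePoints_subset {S : Finset X} (hS : IsClosed (S : Set X)) :
    ((doublePoints S).support : Set X) ⊆ S :=
  support_subset_of_ideal_eq_top hS fun U hU => by
    rw [ideal_doublePoints, iInf₂_eq_top]
    intro p hp
    rw [ideal_point_of_notMem U (hU p hp), Ideal.top_pow]

lemma support_points_subset {S : Finset X} (hS : IsClosed (S : Set X)) :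
    ((points S).support : Set X) ⊆ S :=
  support_subset_of_ideal_eq_top hS fun U hU => by
    rw [ideal_points, iInf₂_eq_top]
    exact fun p hp => ideal_point_of_notMem U (hU p hp)

lemma support_points_inf_doublePoint_subset {S : Finset X} (hS : IsClosed (S : Set X)) {p : X}
    (hp : p ∈ S) : ((points S ⊓ doublePoint p).support : Set X) ⊆ S :=
  support_subset_of_ideal_eq_top hS fun U hU => by
    rw [Scheme.IdealSheafData.ideal_inf, Pi.inf_apply, ideal_points, ideal_doublePoint,
      ideal_point_of_notMem U (hU p hp), Ideal.top_pow, inf_top_eq, iInf₂_eq_top]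
    exact fun q hq => ideal_point_of_notMem U (hU q hq)

/-! ### Rational points -/

section Rational

variable {K : Type u} [Field K] {f : X ⟶ Spec (.of K)} {p : X}

/-- The scalar `c` is the value of `a` at `p`, that is, its pullback along the section `s`. -/
lemma exists_sub_scalars_mem (hp : ∃ s : Spec (.of K) ⟶ X, s ≫ f = 𝟙 _ ∧
    s (IsLocalRing.closedPoint K) = p) (U : X.affineOpens) (hpU : p ∈ U.1) (a : Γ(X, U.1)) :
    ∃ c : K, a - resFun le_top (scalars f c) ∈ (point p).ideal U := by
  obtain ⟨s, hs, rfl⟩ := hp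
  have hsU : s ⁻¹ᵁ U.1 = ⊤ := by
    ext x
    simp only [Opens.coe_top, Set.mem_univ, iff_true]
    rw [Subsingleton.elim x (IsLocalRing.closedPoint K)]
    exact hpU
  have h1 : ∀ c : K, s.app U.1 (resFun le_top (scalars f c)) =
      resFun le_top ((Scheme.ΓSpecIso (.of K)).inv c) := by
    intro c
    have h2 := ConcreteCategory.congr_hom (s.naturality (homOfLE (le_top : U.1 ≤ ⊤)).op) (scalars f c)
    refine h2.trans (congrArg (resFun (X := Spec (.of K)) le_top) ?_)
    change s.appTop (scalars f c) = _
    rw [← scalars_comp, hs]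
    simp [scalars]
  -- Stated for a variable `V` so that the equality `V = ⊤` can be substituted in the type of `b`.
  have h3 : ∀ V : (Spec (.of K)).Opens, V = ⊤ → ∀ b : Γ(Spec (.of K), V),
      ∃ c : K, resFun le_top ((Scheme.ΓSpecIso (.of K)).inv c) = b := by
    rintro _ rfl b
    refine ⟨(Scheme.ΓSpecIso (.of K)).hom b, ?_⟩
    rw [resFun_self]
    simp
  obtain ⟨c, hc⟩ := h3 _ hsU (s.app U.1 a)
  refine ⟨c, ?_⟩
  rw [mem_ideal_point_iff hpU]
  intro h
  have h4 : IsLocalRing.closedPoint K ∈ s ⁻¹ᵁ X.basicOpen (a - resFun le_top (scalars f c)) := h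
  rw [Scheme.preimage_basicOpen, map_sub, h1, hc, sub_self, Scheme.basicOpen_zero] at h4
  exact h4

lemma isMaximal_ideal_point (hp : ∃ s : Spec (.of K) ⟶ X, s ≫ f = 𝟙 _ ∧
    s (IsLocalRing.closedPoint K) = p) (U : X.affineOpens) (hpU : p ∈ U.1) :
    ((point p).ideal U).IsMaximal := by
  have hsurj : Function.Surjective
      ((Ideal.Quotient.mk ((point p).ideal U)).comp ((resFun le_top).comp (scalars f))) := by
    intro b
    obtain ⟨a, rfl⟩ := Ideal.Quotient.mk_surjective b
    obtain ⟨c, hc⟩ := exists_sub_scalars_mem hp U hpU a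
    exact ⟨c, (Ideal.Quotient.eq.2 hc).symm⟩
  have : Nontrivial (Γ(X, U.1) ⧸ (point p).ideal U) := by
    rw [Ideal.Quotient.nontrivial_iff]
    exact fun h => (U.2.primeIdealOf ⟨p, hpU⟩).isPrime.ne_top ((ideal_point_of_mem U.2 hpU).symm.trans h)
  refine Ideal.Quotient.maximal_of_isField _ ?_
  exact MulEquiv.isField (Field.toIsField K) (RingEquiv.ofBijective _
    ⟨RingHom.injective _, hsurj⟩).symm.toMulEquiv

/-- An affine neighbourhood of a point `x` of the closure contains `p`; there the prime of `p` is
maximal and lies in that of `x`. -/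
lemma isClosed_singleton_of_rational (hp : ∃ s : Spec (.of K) ⟶ X, s ≫ f = 𝟙 _ ∧
    s (IsLocalRing.closedPoint K) = p) : IsClosed ({p} : Set X) := by
  refine isClosed_of_closure_subset fun x hx => ?_
  obtain ⟨_, ⟨U, hU, rfl⟩, hxU, -⟩ :=
    X.isBasis_affineOpens.exists_subset_of_mem_open (Set.mem_univ x) isOpen_univ
  replace hU : IsAffineOpen U := hU
  have hpU : p ∈ U := by
    obtain ⟨y, hy, rfl⟩ := mem_closure_iff.1 hx U U.2 hxU
    exact hy
  have h1 := isMaximal_ideal_point hp ⟨U, hU⟩ hpU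
  rw [ideal_point_of_mem hU hpU] at h1
  have h2 : (hU.primeIdealOf ⟨p, hpU⟩).asIdeal ≤ (hU.primeIdealOf ⟨x, hxU⟩).asIdeal := by
    intro a ha
    rw [mem_primeIdealOf_iff] at ha ⊢
    intro hxa
    obtain ⟨y, hy, rfl⟩ := mem_closure_iff.1 hx _ (X.basicOpen a).2 hxa
    exact ha hy
  have h3 := PrimeSpectrum.ext (h1.eq_of_le (hU.primeIdealOf ⟨x, hxU⟩).isPrime.ne_top h2)
  have h4 := congrArg hU.fromSpec h3
  rw [hU.fromSpec_primeIdealOf, hU.fromSpec_primeIdealOf] at h4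
  exact h4.symm

end Rational

end

section

/-! ### Dimension -/

section FiniteType

attribute [local instance] MvPolynomial.gradedAlgebra

variable {K : Type u} [Field K] {X : Scheme.{u}}

lemma algebraMap_homogeneousSubmodule_zero_surjective (N : ℕ) :
    Function.Surjective
      (algebraMap K (MvPolynomial.homogeneousSubmodule (Fin (N + 1)) K 0)) := by
  rintro ⟨a, ha⟩
  have h1 := (MvPolynomial.totalDegree_eq_zero_iff_eq_C (p := a)).1
    (Nat.le_zero.1 (MvPolynomial.IsHomogeneous.totalDegree_le ha))
  exact ⟨_, Subtype.ext h1.symm⟩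

instance locallyOfFiniteType_projectiveSpaceToSpec (N : ℕ) :
    LocallyOfFiniteType (projectiveSpaceToSpec K N) := by
  have : IsScalarTower K (MvPolynomial.homogeneousSubmodule (Fin (N + 1)) K 0)
      (MvPolynomial (Fin (N + 1)) K) :=
    ⟨fun a b c => smul_mul_assoc a (b : MvPolynomial (Fin (N + 1)) K) c⟩
  have : Algebra.FiniteType (MvPolynomial.homogeneousSubmodule (Fin (N + 1)) K 0)
      (MvPolynomial (Fin (N + 1)) K) :=
    Algebra.FiniteType.of_restrictScalars_finiteType K _ _
  have : LocallyOfFiniteType (Spec.map (CommRingCat.ofHom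
      (algebraMap K (MvPolynomial.homogeneousSubmodule (Fin (N + 1)) K 0)))) :=
    (HasRingHomProperty.Spec_iff (P := @LocallyOfFiniteType)).2
      (RingHom.FiniteType.of_surjective _ (algebraMap_homogeneousSubmodule_zero_surjective N))
  exact MorphismProperty.comp_mem _ _ _ inferInstance this

lemma IsProjective.locallyOfFiniteType {f : X ⟶ Spec (.of K)} (hf : IsProjective f) :
    LocallyOfFiniteType f := by
  obtain ⟨N, i, hi, rfl⟩ := hf
  infer_instance

end FiniteType

variable {K : Type u} [Field K] {X : Scheme.{u}} (f : X ⟶ Spec (.of K))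

/-- The `K`-algebra structure of `Γ(X, U)`. -/
abbrev sectionsAlgebra (U : X.Opens) : Algebra K Γ(X, U) :=
  ((resFun le_top).comp (scalars f)).toAlgebra

lemma finiteType_sections [LocallyOfFiniteType f] {U : X.Opens} (hU : IsAffineOpen U) :
    letI := sectionsAlgebra f U
    Algebra.FiniteType K Γ(X, U) := by
  have h1 := LocallyOfFiniteType.finiteType_appLE f (isAffineOpen_top _) hU (e := le_top)
  have h2 : (resFun le_top).comp (scalars f) =
      (f.appLE ⊤ U le_top).hom.comp (Scheme.ΓSpecIso (.of K)).inv.hom := rfl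
  change RingHom.FiniteType ((resFun le_top).comp (scalars f))
  rw [h2]
  exact h1.comp (RingHom.FiniteType.of_surjective _
    (ConcreteCategory.bijective_of_isIso (Scheme.ΓSpecIso (.of K)).inv).2)

lemma ringKrullDim_stalk_eq_height {U : X.Opens} (hU : IsAffineOpen U) {x : X} (hx : x ∈ U) :
    ringKrullDim (X.presheaf.stalk x) = (hU.primeIdealOf ⟨x, hx⟩).asIdeal.height := by
  let := X.presheaf.algebra_section_stalk ⟨x, hx⟩
  have := hU.isLocalization_stalk ⟨x, hx⟩
  exact IsLocalization.AtPrime.ringKrullDim_eq_height (hU.primeIdealOf ⟨x, hx⟩).asIdeal _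

variable [IsIntegral X] [CharZero K]

/-- The number `s` is the transcendence degree of the function field, which does not depend on `U`.
-/
lemma exists_height_eq [LocallyOfFiniteType f] : ∃ s : ℕ, ∀ (U : X.Opens), IsAffineOpen U →
    (U : Set X).Nonempty → ringKrullDim Γ(X, U) ≤ s ∧ ∀ m : Ideal Γ(X, U), m.IsMaximal → m.height = s := by
  have key : ∀ (U : X.Opens), IsAffineOpen U → (U : Set X).Nonempty → ∃ s : ℕ,
      (letI := (functionFieldScalars f).toAlgebra; Algebra.trdeg K X.functionField = s) ∧ ringKrullDim Γ(X, U) ≤ s ∧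
        ∀ m : Ideal Γ(X, U), m.IsMaximal → m.height = s := by
    intro U hU hne
    let := sectionsAlgebra f U
    let := (functionFieldScalars f).toAlgebra
    have : Nonempty U := hne.to_subtype
    have := finiteType_sections f hU
    obtain ⟨s, hs, h1, h2⟩ := exists_trdeg_eq_height_eq K Γ(X, U)
    have := functionField_isFractionRing_of_isAffineOpen X U hU
    have : IsScalarTower K Γ(X, U) X.functionField :=
      IsScalarTower.of_algebraMap_eq fun c => (germ_genericPoint_resFun le_top _ _).symm
    refine ⟨s, ?_, h1, h2⟩
    rw [← trdeg_eq_of_isFractionRing K Γ(X, U) X.functionField, hs]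
  obtain ⟨_, ⟨V, hV, rfl⟩, hxV, -⟩ :=
    X.isBasis_affineOpens.exists_subset_of_mem_open (Set.mem_univ (genericPoint X)) isOpen_univ
  obtain ⟨s, hs, -⟩ := key V hV ⟨_, hxV⟩
  refine ⟨s, fun U hU hne => ?_⟩
  obtain ⟨s', hs', h⟩ := key U hU hne
  have : s = s' := by exact_mod_cast hs.symm.trans hs'
  rwa [this]

lemma topologicalKrullDim_eq_iSup_coheight (X : Scheme.{u}) [Nonempty X] :
    topologicalKrullDim X = ↑(⨆ x : X, Order.coheight x) := by
  rw [← Order.krullDim_eq_iSup_coheight_of_nonempty]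
  exact Order.krullDim_eq_of_orderIso irreducibleSetEquivPoints

/-- The dimension of `X` is the supremum of the dimensions of its local rings. All are at most `s`,
and a rational point, being a maximal ideal of an affine chart, attains `s`. -/
theorem ringKrullDim_stalk_of_rational [LocallyOfFiniteType f] {p : X}
    (hp : ∃ s : Spec (.of K) ⟶ X, s ≫ f = 𝟙 _ ∧ s (IsLocalRing.closedPoint K) = p) :
    ringKrullDim (X.presheaf.stalk p) = topologicalKrullDim X := by
  obtain ⟨s, hs⟩ := exists_height_eq f
  have h1 : ∀ x : X, ringKrullDim (X.presheaf.stalk x) ≤ s := by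
    intro x
    obtain ⟨_, ⟨U, hU, rfl⟩, hxU, -⟩ :=
      X.isBasis_affineOpens.exists_subset_of_mem_open (Set.mem_univ x) isOpen_univ
    rw [ringKrullDim_stalk_eq_height hU hxU]
    exact (Ideal.height_le_ringKrullDim_of_ne_top (hU.primeIdealOf ⟨x, hxU⟩).isPrime.ne_top).trans
      (hs U hU ⟨x, hxU⟩).1
  have h2 : ringKrullDim (X.presheaf.stalk p) = s := by
    obtain ⟨_, ⟨U, hU, rfl⟩, hpU, -⟩ :=
      X.isBasis_affineOpens.exists_subset_of_mem_open (Set.mem_univ p) isOpen_univ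
    have h3 := isMaximal_ideal_point hp ⟨U, hU⟩ hpU
    rw [ideal_point_of_mem hU hpU] at h3
    rw [ringKrullDim_stalk_eq_height hU hpU, (hs U hU ⟨p, hpU⟩).2 _ h3]
    rfl
  rw [h2, topologicalKrullDim_eq_iSup_coheight]
  simp only [ringKrullDim_stalk_eq_coheight] at h1 h2
  have h4 : (⨆ x : X, Order.coheight x) = s :=
    le_antisymm (iSup_le fun x => by exact_mod_cast h1 x)
      ((show (s : ℕ∞) ≤ Order.coheight p by exact_mod_cast h2.ge).trans
        (le_iSup (fun x : X => Order.coheight x) p))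
  rw [h4]
  rfl

end

section

/-! ### Independent conditions as surjectivity of the evaluation -/

lemma finrank_eq_sub_iff_surjective {K V W N : Type*} [Field K] [AddCommGroup V] [Module K V]
    [AddCommGroup W] [Module K W] [AddCommGroup N] [Module K N] [Module.Finite K V]
    [Module.Finite K W] (ev : V →ₗ[K] W) (j : N →ₗ[K] V) (hj : Function.Injective j)
    (h : LinearMap.range j = LinearMap.ker ev) :
    (Module.finrank K N : ℤ) = Module.finrank K V - Module.finrank K W ↔ Function.Surjective ev := by
  have h1 : Module.finrank K N = Module.finrank K (LinearMap.ker ev) := by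
    rw [← h]
    exact (LinearEquiv.ofInjective j hj).finrank_eq
  have h2 := ev.finrank_range_add_finrank_ker
  rw [h1, ← LinearMap.range_eq_top, ← h2]
  constructor
  · intro h3
    apply Submodule.eq_top_of_finrank_eq
    omega
  · intro h3
    rw [h3, finrank_top]
    push_cast
    ring

variable {K : Type u} [Field K] {X : Scheme.{u}} (f : X ⟶ Spec (.of K))

/-! ### Length and evaluation for subschemes supported on `S` -/

section Length

variable {S : Finset X} {U : X → X.affineOpens} (hU : ∀ p ∈ S, p ∈ (U p).1)
  (hdisj : ∀ p ∈ S, ∀ q ∈ S, q ∈ (U p).1 → q = p) {Z : X.IdealSheafData}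
  (hZ : (Z.support : Set X) ⊆ S)

lemma subschemeι_mem (hZ : (Z.support : Set X) ⊆ S) (z : Z.subscheme) : Z.subschemeι z ∈ S :=
  hZ (Z.range_subschemeι ▸ Set.mem_range_self z)

include hU hdisj hZ in
-- The opens `U p` may overlap in `X`, but their traces on `Z` are disjoint, because `Z` has no
-- points outside `S`.
lemma bijective_restrict_subscheme : Function.Bijective
    (RingHom.pi fun p : S => resFun (X := Z.subscheme) (le_top : Z.subschemeι ⁻¹ᵁ (U p.1).1 ≤ ⊤)) := by
  have hcov : ∀ z : Z.subscheme, ∃ p : S, z ∈ Z.subschemeι ⁻¹ᵁ (U p.1).1 := fun z =>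
    ⟨⟨_, subschemeι_mem hZ z⟩, hU _ (subschemeι_mem hZ z)⟩
  constructor
  · intro a b hab
    refine Z.subscheme.sheaf.eq_of_locally_eq' (fun p : S => Z.subschemeι ⁻¹ᵁ (U p.1).1) ⊤
      (fun p => homOfLE le_top) (fun z _ => Opens.mem_iSup.2 (hcov z)) a b fun p => congrFun hab p
  · intro a
    obtain ⟨t, ht, -⟩ := Z.subscheme.sheaf.existsUnique_gluing'
      (fun p : S => Z.subschemeι ⁻¹ᵁ (U p.1).1) ⊤
      (fun p => homOfLE le_top) (fun z _ => Opens.mem_iSup.2 (hcov z)) a (fun p q => by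
        by_cases hpq : p = q
        · subst hpq
          rfl
        · have hbot : Z.subschemeι ⁻¹ᵁ (U p.1).1 ⊓ Z.subschemeι ⁻¹ᵁ (U q.1).1 = ⊥ := by
            rw [eq_bot_iff]
            rintro z ⟨hzp, hzq⟩
            have h1 := hdisj p.1 p.2 _ (subschemeι_mem hZ z) hzp
            have h2 := hdisj q.1 q.2 _ (subschemeι_mem hZ z) hzq
            exact hpq (Subtype.ext (h1.symm.trans h2))
          have : Subsingleton Γ(Z.subscheme, Z.subschemeι ⁻¹ᵁ (U p.1).1 ⊓ Z.subschemeι ⁻¹ᵁ (U q.1).1) := by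
            rw [hbot]
            infer_instance
          exact this.elim _ _)
    exact ⟨t, funext fun p => ht p⟩

/-- The sections of `𝒪_Z` over the trace of an affine open set. -/
def quotientEquivSections (Z : X.IdealSheafData) (V : X.affineOpens) :
    (Γ(X, V.1) ⧸ Z.ideal V) ≃+* Γ(Z.subscheme, Z.subschemeι ⁻¹ᵁ V.1) :=
  (Ideal.quotEquivOfEq (Z.ker_subschemeι_app V).symm).trans
    (RingHom.quotientKerEquivOfSurjective (f := (Z.subschemeι.app V.1).hom)
      (Z.subschemeι_app_surjective V))

include hU hdisj hZ in
lemma length_eq_finrank_pi :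
    letI := fun V => sectionsAlgebra f V
    length f Z = Module.finrank K (∀ p : S, Γ(X, (U p.1).1) ⧸ Z.ideal (U p.1)) := by
  let := fun V => sectionsAlgebra f V
  let : Algebra K Γ(Z.subscheme, ⊤) := (scalars (Z.subschemeι ≫ f)).toAlgebra
  let e : Γ(Z.subscheme, ⊤) ≃+* ∀ p : S, Γ(X, (U p.1).1) ⧸ Z.ideal (U p.1) :=
    (RingEquiv.ofBijective _ (bijective_restrict_subscheme hU hdisj hZ)).trans
      (RingEquiv.piCongrRight fun p => (quotientEquivSections Z (U p.1)).symm)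
  have he : ∀ c : K, e (algebraMap K _ c) = algebraMap K _ c := by
    intro c
    funext p
    refine (RingEquiv.symm_apply_eq (quotientEquivSections Z (U p.1))).2 ?_
    change resFun le_top (scalars (Z.subschemeι ≫ f) c) =
      Z.subschemeι.app (U p.1).1 (resFun le_top (scalars f c))
    rw [scalars_comp]
    exact (ConcreteCategory.congr_hom (Z.subschemeι.naturality
      (homOfLE (le_top : (U p.1).1 ≤ ⊤)).op) (scalars f c)).symm
  exact (AlgEquiv.ofRingEquiv he).toLinearEquiv.finrank_eq

variable {L : X.Modules} (hL : HasLocalGenerators L) {e : ∀ p : S, Γ(L, (U p.1).1)}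
  (he : ∀ p, IsGenerator L (e p))

include hL hU hZ in
lemma exists_mulMap_eq_iff_forall (hS : IsClosed (S : Set X)) (s : Γ(L, ⊤)) :
    (∃ t, (mulMap Z L).app ⊤ t = s) ↔
      ∀ p : S, (he p).coeff (res L le_top s) ∈ Z.ideal (U p.1) := by
  have h1 : ∀ (p : S) (a : Γ(X, (U p.1).1)), a ∈ Z.ideal (U p.1) ↔
      Z.subschemeι.app (U p.1).1 a = 0 := fun p a => by
    rw [← Z.ker_subschemeι_app]
    rfl
  constructor
  · rintro ⟨t, rfl⟩ p
    rw [h1, ← exists_mulMap_eq_iff Z (he p), (he p).coeff_smul]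
    exact ⟨res _ le_top t, app_res _ _ _⟩
  · intro h
    refine mem_range_mulMap_of_locally Z hL s fun x => ?_
    by_cases hx : x ∈ S
    · exact ⟨(U x).1, hU x hx, e ⟨x, hx⟩, he ⟨x, hx⟩, (he ⟨x, hx⟩).coeff (res L le_top s),
        ((he ⟨x, hx⟩).coeff_smul (res L le_top s)).symm, (h1 ⟨x, hx⟩ _).1 (h ⟨x, hx⟩)⟩
    · obtain ⟨V, hxV, e', he'⟩ := hL x
      -- Away from `S` the trace of `Z` is empty, so every coefficient lies in its ideal.
      let W : X.Opens := V ⊓ ⟨(S : Set X)ᶜ, hS.isOpen_compl⟩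
      have hW := he'.res (inf_le_left : W ≤ V)
      refine ⟨W, ⟨hxV, hx⟩, _, hW, hW.coeff (res L le_top s),
        (hW.coeff_smul (res L le_top s)).symm, ?_⟩
      have hbot : Z.subschemeι ⁻¹ᵁ W = ⊥ := by
        rw [eq_bot_iff]
        rintro z hz
        exact hz.2 (subschemeι_mem hZ z)
      have : Subsingleton Γ(Z.subscheme, Z.subschemeι ⁻¹ᵁ W) := by
        rw [hbot]
        infer_instance
      exact this.elim _ _

include hL hU hdisj hZ in
-- Surjectivity of evaluation is phrased with representatives `c p` rather than residue classes, so
-- that the conditions for `S`, `S ∪ 2p` and `2S` refer to the same data.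
theorem imposesIndependentConditions_iff (hS : IsClosed (S : Set X))
    (hfin : letI : Module K Γ(L, ⊤) := Module.compHom _ (scalars f); Module.Finite K Γ(L, ⊤))
    (hfin' : ∀ p : S, letI := sectionsAlgebra f (U p.1).1
      Module.Finite K (Γ(X, (U p.1).1) ⧸ Z.ideal (U p.1))) :
    ImposesIndependentConditions f Z L ↔ ∀ c : (p : S) → Γ(X, (U p.1).1),
      ∃ s : Γ(L, ⊤), ∀ p, (he p).coeff (res L le_top s) - c p ∈ Z.ideal (U p.1) := by
  let := fun V => sectionsAlgebra f V
  let : Module K Γ(L, ⊤) := Module.compHom _ (scalars f)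
  let : Module K Γ(tensor (idealSheaf Z) L, ⊤) := Module.compHom _ (scalars f)
  let ev : Γ(L, ⊤) →ₗ[K] ∀ p : S, Γ(X, (U p.1).1) ⧸ Z.ideal (U p.1) :=
    { toFun := fun s p => Ideal.Quotient.mk _ ((he p).coeff (res L le_top s))
      map_add' := fun s t => funext fun p => by simp only [map_add, Pi.add_apply]
      map_smul' := fun c s => funext fun p => by
        have h1 : c • s = scalars f c • s := rfl
        rw [h1, res_smul, map_smul, smul_eq_mul, map_mul, Pi.smul_apply, Algebra.smul_def]
        rfl }
  let j : Γ(tensor (idealSheaf Z) L, ⊤) →ₗ[K] Γ(L, ⊤) :=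
    { toFun := (mulMap Z L).app ⊤
      map_add' := map_add _
      map_smul' := fun c s => Scheme.Modules.Hom.app_smul (mulMap Z L) (scalars f c) s }
  have := hfin
  have := hfin'
  have hev : ∀ (s : Γ(L, ⊤)) (c : (p : S) → Γ(X, (U p.1).1)), ev s = (fun p => Ideal.Quotient.mk _ (c p)) ↔
      ∀ p, (he p).coeff (res L le_top s) - c p ∈ Z.ideal (U p.1) := fun s c => by
    rw [funext_iff]
    exact forall_congr' fun p => Ideal.Quotient.eq
  have hker : LinearMap.range j = LinearMap.ker ev := by
    ext s
    have h1 := hev s 0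
    simp only [Pi.zero_apply, map_zero, sub_zero] at h1
    rw [LinearMap.mem_ker]
    exact (exists_mulMap_eq_iff_forall hU hZ hL he hS s).trans h1.symm
  have h1 := finrank_eq_sub_iff_surjective ev j (mulMap_injective Z hL ⊤) hker
  rw [← length_eq_finrank_pi f hU hdisj hZ] at h1
  refine Iff.trans h1 ⟨fun h c => ?_, fun h w => ?_⟩
  · obtain ⟨s, hs⟩ := h fun p => Ideal.Quotient.mk _ (c p)
    exact ⟨s, (hev s c).1 hs⟩
  · choose c hc using fun p => Ideal.Quotient.mk_surjective (w p)
    obtain ⟨s, hs⟩ := h c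
    exact ⟨s, ((hev s c).2 hs).trans (funext hc)⟩

end Length

end

section

variable {X : Scheme.{u}}

/-! ### Double points and tensor products -/

lemma IsGenerator.coeff_tmul {M N : X.Modules} {U : X.Opens} {e : Γ(M, U)} {e' : Γ(N, U)}
    (he : IsGenerator M e) (he' : IsGenerator N e') (s : Γ(M, U)) (t : Γ(N, U)) :
    (he.tmul he').coeff (Terracini.tmul s t) = he.coeff s * he'.coeff t := by
  rw [IsGenerator.coeff_eq_iff, mul_smul, ← smul_tmul_right, ← smul_tmul_left, he.coeff_smul,
    he'.coeff_smul]

/-- If `S ∪ 2p` for `p ∈ S` and `S` can be interpolated by two systems of functions, then `2S` can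
be interpolated by sums of products. -/
lemma exists_sum_mul_sub_mem_sq {ι V₁ V₂ W : Type*} [Fintype ι] [DecidableEq ι] {A : ι → Type*}
    [∀ i, CommRing (A i)] [AddCommMonoid W] (m : ∀ i, Ideal (A i)) (ev₁ : V₁ → ∀ i, A i)
    (ev₂ : V₂ → ∀ i, A i) (ev : W →+ ∀ i, A i) (μ : V₁ → V₂ → W)
    (hμ : ∀ s t i, ev (μ s t) i = ev₁ s i * ev₂ t i)
    (h₁ : ∀ p, ∀ c : ∀ i, A i, ∃ s, ev₁ s p - c p ∈ m p ^ 2 ∧ ∀ q ≠ p, ev₁ s q - c q ∈ m q)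
    (h₂ : ∀ c : ∀ i, A i, ∃ t, ∀ q, ev₂ t q - c q ∈ m q) (c : ∀ i, A i) :
    ∃ w, ∀ q, ev w q - c q ∈ m q ^ 2 := by
  have key : ∀ p, ∃ w, ev w p - c p ∈ m p ^ 2 ∧ ∀ q ≠ p, ev w q ∈ m q ^ 2 := by
    intro p
    obtain ⟨t, ht⟩ := h₂ (Pi.single p 1)
    -- Since `t ≡ 1` modulo `m p`, the factor `2 - t` inverts `t` modulo `m p ^ 2`; it corrects the
    -- uncontrolled first-order part of `t`.
    obtain ⟨s, hs, hs'⟩ := h₁ p (Pi.single p (c p * (2 - ev₂ t p)))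
    refine ⟨μ s t, ?_, fun q hq => ?_⟩
    · have ht' := ht p
      rw [Pi.single_eq_same] at hs ht'
      have h1 : ev (μ s t) p - c p =
          (ev₁ s p - c p * (2 - ev₂ t p)) * ev₂ t p - c p * (ev₂ t p - 1) ^ 2 := by
        rw [hμ]
        ring
      rw [h1]
      exact sub_mem (Ideal.mul_mem_right _ _ hs) (Ideal.mul_mem_left _ _ (Ideal.pow_mem_pow ht' 2))
    -- Away from `p` both factors lie in `m q`, so the product lies in `m q ^ 2`.
    · have ht' := ht q
      have hs'' := hs' q hq
      rw [Pi.single_eq_of_ne hq, sub_zero] at hs'' ht'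
      rw [hμ, pow_two]
      exact Ideal.mul_mem_mul hs'' ht'
  choose w hw hw' using key
  refine ⟨∑ p, w p, fun q => ?_⟩
  rw [map_sum, Finset.sum_apply, ← Finset.add_sum_erase _ _ (Finset.mem_univ q), add_sub_right_comm]
  exact add_mem (hw q) (sum_mem fun p hp => hw' p q (Finset.ne_of_mem_erase hp).symm)

lemma exists_affineOpens_isGenerator {S : Finset X} (hS : ∀ p ∈ S, IsClosed ({p} : Set X))
    {L₁ L₂ : X.Modules} (hL₁ : HasLocalGenerators L₁) (hL₂ : HasLocalGenerators L₂) (p : X) :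
    ∃ U : X.affineOpens, p ∈ U.1 ∧ (∀ q ∈ S, q ∈ U.1 → q = p) ∧
      (∃ e : Γ(L₁, U.1), IsGenerator L₁ e) ∧ ∃ e : Γ(L₂, U.1), IsGenerator L₂ e := by
  classical
  obtain ⟨V₁, hV₁, e₁, he₁⟩ := hL₁ p
  obtain ⟨V₂, hV₂, e₂, he₂⟩ := hL₂ p
  have hclosed : IsClosed ((S.erase p : Finset X) : Set X) := by
    rw [← Set.biUnion_of_singleton ((S.erase p : Finset X) : Set X)]
    exact (Finset.finite_toSet _).isClosed_biUnion fun q hq =>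
      hS q (Finset.mem_of_mem_erase hq)
  obtain ⟨_, ⟨U, hU, rfl⟩, hpU, hUV⟩ := X.isBasis_affineOpens.exists_subset_of_mem_open
    (show p ∈ (V₁ : Set X) ∩ V₂ ∩ ((S.erase p : Finset X) : Set X)ᶜ from ⟨⟨hV₁, hV₂⟩, by simp⟩)
    ((V₁.2.inter V₂.2).inter hclosed.isOpen_compl)
  refine ⟨⟨U, hU⟩, hpU, fun q hq hqU => ?_, ⟨_, he₁.res fun x hx => (hUV hx).1.1⟩,
    ⟨_, he₂.res fun x hx => (hUV hx).1.2⟩⟩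
  by_contra hqp
  exact (hUV hqU).2 (Finset.mem_coe.2 (Finset.mem_erase.2 ⟨hqp, hq⟩))

variable {K : Type u} [Field K] {f : X ⟶ Spec (.of K)}

lemma finite_quotient_ideal_point {p : X} (hp : IsRegularPoint f p) (U : X.affineOpens) (hpU : p ∈ U.1) :
    letI := sectionsAlgebra f U.1
    Module.Finite K (Γ(X, U.1) ⧸ (point p).ideal U) := by
  let := sectionsAlgebra f U.1
  refine finite_of_algebraMap_surjective _ ?_
  intro b
  obtain ⟨a, rfl⟩ := Ideal.Quotient.mk_surjective b
  obtain ⟨c, hc⟩ := exists_sub_scalars_mem hp.rational U hpU a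
  exact ⟨c, (Ideal.Quotient.eq.2 hc).symm⟩

variable [CharZero K] [IsIntegral X]

lemma finrank_quotient_ideal_point_sq [LocallyOfFiniteType f] {n : ℕ}
    (hn : topologicalKrullDim X = n) {p : X} (hp : IsRegularPoint f p) (U : X.affineOpens)
    (hpU : p ∈ U.1) :
    letI := sectionsAlgebra f U.1
    Module.Finite K (Γ(X, U.1) ⧸ (point p).ideal U ^ 2) ∧
      Module.finrank K (Γ(X, U.1) ⧸ (point p).ideal U ^ 2) = n + 1 := by
  let := sectionsAlgebra f U.1
  have := isMaximal_ideal_point hp.rational U hpU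
  have hsurj : Function.Surjective (algebraMap K (Γ(X, U.1) ⧸ (point p).ideal U)) := by
    intro b
    obtain ⟨a, rfl⟩ := Ideal.Quotient.mk_surjective b
    obtain ⟨c, hc⟩ := exists_sub_scalars_mem hp.rational U hpU a
    exact ⟨c, (Ideal.Quotient.eq.2 hc).symm⟩
  have hU : IsAffineOpen U.1 := U.2
  let := X.presheaf.algebra_section_stalk ⟨p, hpU⟩
  have h1 := hU.isLocalization_stalk ⟨p, hpU⟩
  have h2 : IsLocalization.AtPrime (X.presheaf.stalk p) ((point p).ideal U) := by
    have h3 := ideal_point_of_mem hU hpU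
    convert h1
  have := hp.regular
  exact finrank_quotient_sq_of_isRegularLocalRing ((point p).ideal U) hsurj (X.presheaf.stalk p)
    ((ringKrullDim_stalk_of_rational f hp.rational).trans hn)

/-- On the common neighbourhoods `U q` the ideals of `S`, `S ∪ 2p` and `2S` are each `𝔪_q` or
`𝔪_q²`, and coefficients of `s ⊗ t` are products of coefficients, so the interpolation lemma
applies. -/
theorem doublePoints_tensor (hf : IsProjective f) {n : ℕ} (hn : topologicalKrullDim X = n)
    {L₁ L₂ : X.Modules} (hL₁ : HasLocalGenerators L₁) (hL₂ : HasLocalGenerators L₂)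
    {S : Finset X} (hS : ∀ p ∈ S, IsRegularPoint f p) (hdagger : ConditionDagger f L₁ S)
    (hind : ImposesIndependentConditions f (points S) L₂) :
    ImposesIndependentConditions f (doublePoints S) (tensor L₁ L₂) ∧
      length f (doublePoints S) = (n + 1) * S.card := by
  classical
  have := hf.locallyOfFiniteType
  have hcl : ∀ p ∈ S, IsClosed ({p} : Set X) := fun p hp =>
    isClosed_singleton_of_rational (hS p hp).rational
  have hSc : IsClosed (S : Set X) := by
    rw [← Set.biUnion_of_singleton (S : Set X)]
    exact S.finite_toSet.isClosed_biUnion hcl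
  choose U hU hdisj he₁ he₂ using exists_affineOpens_isGenerator hcl hL₁ hL₂
  choose e₁ he₁ using he₁
  choose e₂ he₂ using he₂
  have hdisj' : ∀ p ∈ S, ∀ q ∈ S, q ∈ (U p).1 → q = p := fun p _ => hdisj p
  have hU' : ∀ p ∈ S, p ∈ (U p).1 := fun p _ => hU p
  have hq : ∀ p : S, (points S).ideal (U p.1) = (point p.1).ideal (U p.1) := fun p =>
    ideal_points_eq p.2 (hdisj p.1)
  have hq2 : ∀ p : S, (doublePoints S).ideal (U p.1) = (point p.1).ideal (U p.1) ^ 2 := fun p =>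
    ideal_doublePoints_eq p.2 (hdisj p.1)
  have hqd : ∀ p : S, (points S ⊓ doublePoint p.1).ideal (U p.1) = (point p.1).ideal (U p.1) ^ 2 :=
    fun p => ideal_points_inf_doublePoint p.2 (hdisj p.1)
  have hqn : ∀ p q : S, q ≠ p →
      (points S ⊓ doublePoint p.1).ideal (U q.1) = (point q.1).ideal (U q.1) := fun p q hpq =>
    ideal_points_inf_doublePoint_of_ne q.2 p.2 (hdisj q.1) fun h => hpq (Subtype.ext h).symm
  have hfin : ∀ p : S, letI := sectionsAlgebra f (U p.1).1
      Module.Finite K (Γ(X, (U p.1).1) ⧸ (point p.1).ideal (U p.1)) := fun p =>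
    finite_quotient_ideal_point (hS p.1 p.2) _ (hU p.1)
  have hfin2 := fun p : S => finrank_quotient_ideal_point_sq hn (hS p.1 p.2) _ (hU p.1)
  have hL := hL₁.tensor hL₂
  have h₂ := (imposesIndependentConditions_iff f hU' hdisj' (support_points_subset hSc) hL₂
    (fun p : S => he₂ p.1) hSc (finite_sections f hf hL₂) fun p => by
      rw [hq]
      exact hfin p).1 hind
  have h₁ := fun p : S => (imposesIndependentConditions_iff f hU' hdisj'
    (support_points_inf_doublePoint_subset hSc p.2) hL₁ (fun p : S => he₁ p.1) hSc
    (finite_sections f hf hL₁) fun q => by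
      by_cases hqp : q = p
      · rw [hqp, hqd]
        exact (hfin2 p).1
      · rw [hqn p q hqp]
        exact hfin q).1 (hdagger p.1 p.2)
  refine ⟨(imposesIndependentConditions_iff f hU' hdisj' (support_doublePoints_subset hSc) hL
    (fun p : S => (he₁ p.1).tmul (he₂ p.1)) hSc (finite_sections f hf hL) fun p => by
      rw [hq2]
      exact (hfin2 p).1).2 fun c => ?_, ?_⟩
  · obtain ⟨w, hw⟩ := exists_sum_mul_sub_mem_sq (fun p : S => (point p.1).ideal (U p.1))
      (fun s p => (he₁ p.1).coeff (res L₁ le_top s)) (fun t p => (he₂ p.1).coeff (res L₂ le_top t))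
      (AddMonoidHom.mk' (fun w (p : S) => ((he₁ p.1).tmul (he₂ p.1)).coeff (res _ le_top w))
        fun v w => funext fun p => by simp only [map_add, Pi.add_apply])
      (fun s t => tmul s t) (fun s t p => by
        change ((he₁ p.1).tmul (he₂ p.1)).coeff (res _ le_top (tmul s t)) = _
        rw [res_tmul, IsGenerator.coeff_tmul]) (fun p c => by
          obtain ⟨s, hs⟩ := h₁ p c
          refine ⟨s, ?_, fun q hqp => ?_⟩
          · rw [← hqd]
            exact hs p
          · rw [← hqn p q hqp]
            exact hs q) (fun c => by
          obtain ⟨t, ht⟩ := h₂ c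
          refine ⟨t, fun q => ?_⟩
          rw [← hq]
          exact ht q) c
    refine ⟨w, fun p => ?_⟩
    rw [hq2]
    exact hw p
  · let := fun V => sectionsAlgebra f V
    rw [length_eq_finrank_pi f hU' hdisj' (support_doublePoints_subset hSc)]
    have h3 : ∀ p : S, Module.Finite K (Γ(X, (U p.1).1) ⧸ (doublePoints S).ideal (U p.1)) := by
      intro p
      rw [hq2]
      exact (hfin2 p).1
    have h4 : ∀ p : S, Module.finrank K (Γ(X, (U p.1).1) ⧸ (doublePoints S).ideal (U p.1)) =
        n + 1 := by
      intro p
      rw [hq2]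
      exact (hfin2 p).2
    rw [Module.finrank_pi_fintype, Finset.sum_congr rfl fun p _ => h4 p]
    simp [mul_comm]

end

end Terracini

end

theorem theorem3p5 {K : Type u} [Field K] [CharZero K] {X : Scheme.{u}} [AlgebraicGeometry.IsIntegral X]
    (f : X ⟶ Spec (.of K)) (hf : Terracini.IsProjective f)
    (n : ℕ) (hn : topologicalKrullDim X = n)
    (L₁ L₂ : X.Modules) (hL₁ : Terracini.IsLineBundle L₁) (hL₂ : Terracini.IsLineBundle L₂)
    (r : ℕ) (S : Finset X) (hS : ∀ p ∈ S, Terracini.IsRegularPoint f p) (hr : S.card = r)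
    (hdagger : Terracini.ConditionDagger f L₁ S)
    (hind : Terracini.ImposesIndependentConditions f (Terracini.points S) L₂) :
    Terracini.ImposesIndependentConditions f (Terracini.doublePoints S)
        (Terracini.tensor L₁ L₂) ∧
      (Terracini.h0 f (Terracini.tensor (Terracini.idealSheaf (Terracini.doublePoints S))
          (Terracini.tensor L₁ L₂)) : ℤ) =
        (Terracini.h0 f (Terracini.tensor L₁ L₂) : ℤ) - ((n : ℤ) + 1) * (r : ℤ) ∧
      S ∉ Terracini.terraciniLocus f n r (Terracini.tensor L₁ L₂) := by
  obtain ⟨h1, h2⟩ := Terracini.doublePoints_tensor hf hn hL₁.hasLocalGenerators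
    hL₂.hasLocalGenerators hS hdagger hind
  have h3 := h1
  rw [Terracini.ImposesIndependentConditions, h2, hr] at h3
  push_cast at h3
  exact ⟨h1, h3, fun h => h.2.2.ne' h3⟩
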